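/- The characteristic polynomial of a finite simple graph $G$ with adjacency matrix $A$ is $\phi(G,x)=\det(xI-A)$. Two vertices $u,v$ of $G$ are cospectral if $\phi(G\setminus u,x)=\phi(G\setminus v,x)$, where $G\setminus u$ is obtained from $G$ by deleting $u$ and its incident edges; they are similar if some automorphism of $G$ takes $u$ to $v$. For every integer $k\ge 2$, almost all trees have $k$ pairwise cospectral and pairwise non-similar vertices. That is, if $t_n$ is the number of isomorphism classes of trees on $n$ vertices, and $t_n^{(k)}$ is the number of isomorphism classes of trees on $n$ vertices that contain $k$ distinct vertices which are pairwise cospectral and pairwise non-similar, then $$\lim_{n\to\infty}\frac{t_n^{(k)}}{t_n}=1 .$$ -/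

import Mathlib

namespace TreeCospec

/-- The characteristic polynomial `φ(G, x) = det (x I - A)` of a finite graph `G` with adjacency
matrix `A`. -/
noncomputable def charPoly {V : Type*} [Fintype V] (G : SimpleGraph V) : Polynomial ℤ := by
  classical exact (G.adjMatrix ℤ).charpoly

/-- The graph `G \ v`, obtained by deleting the vertex `v` and all edges incident with it. -/
def deleteVertex {V : Type*} (G : SimpleGraph V) (v : V) : SimpleGraph {w : V // w ≠ v} :=
  G.comap Subtype.val

open Classical in
/-- Vertices `v₁` of `G₁` and `v₂` of `G₂` are cospectral if `φ(G₁ \ v₁) = φ(G₂ \ v₂)`. -/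
def CospectralVertices {V₁ V₂ : Type*} [Fintype V₁] [Fintype V₂]
    (G₁ : SimpleGraph V₁) (v₁ : V₁) (G₂ : SimpleGraph V₂) (v₂ : V₂) : Prop :=
  charPoly (deleteVertex G₁ v₁) = charPoly (deleteVertex G₂ v₂)

/-- Two vertices of `G` are similar if some automorphism of `G` takes one to the other. -/
def SimilarVertices {V : Type*} (G : SimpleGraph V) (u v : V) : Prop :=
  ∃ σ : G ≃g G, σ u = v

/-- `G` has `k` vertices that are pairwise cospectral and pairwise non-similar. -/
def HasCospectralNonsimilar {V : Type*} [Fintype V] (k : ℕ) (G : SimpleGraph V) : Prop :=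
  ∃ S : Finset V, S.card = k ∧
    ∀ u ∈ S, ∀ v ∈ S, u ≠ v → CospectralVertices G u G v ∧ ¬ SimilarVertices G u v

theorem charPoly_congr {V W : Type*} [Fintype V] [Fintype W] {G : SimpleGraph V}
    {H : SimpleGraph W} (e : G ≃g H) : charPoly G = charPoly H := by
  classical
  unfold charPoly
  have h : H.adjMatrix ℤ = Matrix.reindex e.toEquiv e.toEquiv (G.adjMatrix ℤ) := by
    ext i j
    simp only [SimpleGraph.adjMatrix_apply, Matrix.reindex_apply, Matrix.submatrix_apply]
    congr 1
    exact propext (e.symm.map_adj_iff (v := i) (w := j)).symm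
  convert (Matrix.charpoly_reindex e.toEquiv (G.adjMatrix ℤ)).symm using 2

/-- An isomorphism restricts to an isomorphism of vertex-deleted subgraphs. -/
def deleteVertexIso {V W : Type*} {G : SimpleGraph V} {H : SimpleGraph W} (e : G ≃g H) (v : V) :
    deleteVertex G v ≃g deleteVertex H (e v) where
  toEquiv := e.toEquiv.subtypeEquiv fun a => by simp
  map_rel_iff' := by
    intro a b
    exact e.map_adj_iff

theorem HasCospectralNonsimilar.congr {V W : Type*} [Fintype V] [Fintype W] {k : ℕ}
    {G : SimpleGraph V} {H : SimpleGraph W} (e : G ≃g H) (h : HasCospectralNonsimilar k G) :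
    HasCospectralNonsimilar k H := by
  classical
  obtain ⟨S, hS, h⟩ := h
  refine ⟨S.map e.toEquiv.toEmbedding, by simpa using hS, ?_⟩
  intro u hu v hv huv
  obtain ⟨a, ha, rfl⟩ := Finset.mem_map.1 hu
  obtain ⟨b, hb, rfl⟩ := Finset.mem_map.1 hv
  obtain ⟨h1, h2⟩ := h a ha b hb (fun hab => huv (by rw [hab]))
  refine ⟨?_, ?_⟩
  · have ea := charPoly_congr (deleteVertexIso e a)
    have eb := charPoly_congr (deleteVertexIso e b)
    unfold CospectralVertices at h1 ⊢
    exact (ea.symm.trans (by convert h1)).trans eb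
  · rintro ⟨σ, hσ⟩
    refine h2 ⟨(e.trans σ).trans e.symm, ?_⟩
    have hs : σ (e a) = e b := hσ
    simp [hs]

/-- Isomorphism, as an equivalence relation on the trees with vertex set `Fin n`. -/
def treeSetoid (n : ℕ) : Setoid {G : SimpleGraph (Fin n) // G.IsTree} where
  r T T' := Nonempty (T.1 ≃g T'.1)
  iseqv :=
    { refl := fun _ => ⟨SimpleGraph.Iso.refl⟩
      symm := fun ⟨e⟩ => ⟨e.symm⟩
      trans := fun ⟨e⟩ ⟨f⟩ => ⟨e.trans f⟩ }

/-- The (unlabelled) trees on `n` vertices: trees on `n` vertices up to isomorphism. -/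
def Tree (n : ℕ) : Type := Quotient (treeSetoid n)

instance (n : ℕ) : Finite (Tree n) := by
  unfold Tree
  infer_instance

/-- The unlabelled tree `T` has `k` vertices that are pairwise cospectral and pairwise
non-similar. -/
def Tree.HasCospectralNonsimilar {n : ℕ} (k : ℕ) (T : Tree n) : Prop :=
  Quotient.lift (s := treeSetoid n) (fun G => TreeCospec.HasCospectralNonsimilar k G.1)
    (fun _ _ ⟨e⟩ => propext ⟨fun h => h.congr e, fun h => h.congr e.symm⟩) T

/-- Almost all trees have property `P`: the proportion of `n`-vertex trees (up to isomorphism)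
with property `P` tends to `1` as `n` tends to infinity. -/
def AlmostAllTrees (P : ∀ {n : ℕ}, Tree n → Prop) : Prop :=
  Filter.Tendsto
    (fun n : ℕ => (Nat.card {T : Tree n // P T} : ℝ) / (Nat.card (Tree n) : ℝ))
    Filter.atTop (nhds 1)

end TreeCospec

/-! A limb is a rooted tree carrying `k` marked vertices that stay cospectral and non-similar in
every tree having it as a branch. Two facts are needed: limbs exist for every `k`, and almost every
tree contains a given limb.

Existence. Across one joining edge, characteristic polynomials obey a bilinear rule
(`delPoly_joinAt`). Marked vertices `y` with the same `vertPoly` and `vertRootPoly` therefore keep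
equal polynomials when the limb is grafted onto anything. Non-similarity is witnessed by
transmission, the sum of distances from a vertex. Grafting shifts the transmissions of marked
vertices of equal depth by a common constant, so distinct ones stay distinct
(`HasLimbVertices.graft_right`). Starting from one vertex, `doubling` doubles the number of marked
vertices (`HasLimbVertices.exists_double`).

Counting. Matula numbers identify rooted trees with positive integers, children of the root with
prime factors, and hence the generating function `T` with an Euler product. This gives `T = F * exp
T`, where `F` is `regularFactor`. If `T` converges at `x`, then `F x ≤ exp (-1)`. Conversely that
inequality bounds all partial sums of `T` by `1`. The radius `ρ` is thus the largest `x` at which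
those bounds hold, and `F` is continuous at `ρ`. Leaving out the trees with a given limb wins a
positive amount in the same induction, which then still runs for some `x > ρ` (`exists_sum_le_one`).
Limb-free rooted trees are thus exponentially rare, against a lower bound on all rooted trees that
comes from supermultiplicativity. An unrooted tree on `n` vertices has at most `n` rootings, and a
factor `n` does no harm (`tendsto_rootedCount_div`). -/

namespace TreeCospec

/-! ### Joining two graphs by an edge. -/

section JoinAt

variable {V W V' W' U : Type*}

/-- Two graphs joined by one edge. -/
def joinAt (G : SimpleGraph V) (v : V) (H : SimpleGraph W) (w : W) : SimpleGraph (V ⊕ W) :=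
  G.sum H ⊔ SimpleGraph.edge (Sum.inl v) (Sum.inr w)

@[simp] theorem joinAt_inl_inl {G : SimpleGraph V} {v : V} {H : SimpleGraph W} {w : W} {a b : V} :
    (joinAt G v H w).Adj (Sum.inl a) (Sum.inl b) ↔ G.Adj a b := by
  simp [joinAt, SimpleGraph.edge_adj]

@[simp] theorem joinAt_inr_inr {G : SimpleGraph V} {v : V} {H : SimpleGraph W} {w : W} {a b : W} :
    (joinAt G v H w).Adj (Sum.inr a) (Sum.inr b) ↔ H.Adj a b := by
  simp [joinAt, SimpleGraph.edge_adj]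

@[simp] theorem joinAt_inl_inr {G : SimpleGraph V} {v : V} {H : SimpleGraph W} {w : W} {a : V}
    {b : W} : (joinAt G v H w).Adj (Sum.inl a) (Sum.inr b) ↔ a = v ∧ b = w := by
  simp [joinAt, SimpleGraph.edge_adj]

@[simp] theorem joinAt_inr_inl {G : SimpleGraph V} {v : V} {H : SimpleGraph W} {w : W} {a : V}
    {b : W} : (joinAt G v H w).Adj (Sum.inr b) (Sum.inl a) ↔ a = v ∧ b = w := by
  simp [joinAt, SimpleGraph.edge_adj, and_comm]

theorem isTree_joinAt [Finite V] [Finite W] {G : SimpleGraph V} (hG : G.IsTree) (v : V)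
    {H : SimpleGraph W} (hH : H.IsTree) (w : W) : (joinAt G v H w).IsTree := by
  have hG' := SimpleGraph.isTree_iff_connected_and_card.1 hG
  have hH' := SimpleGraph.isTree_iff_connected_and_card.1 hH
  refine SimpleGraph.isTree_iff_connected_and_card.2
    ⟨hG.connected.sum_sup_edge hH.connected, ?_⟩
  have h1 : (joinAt G v H w).edgeSet =
      insert s(Sum.inl v, Sum.inr w) (G.sum H).edgeSet := by
    rw [joinAt, SimpleGraph.edgeSet_sup, SimpleGraph.edgeSet_edge_of_ne (by simp),
      Set.union_comm]
    rfl
  have h2 : Nat.card (joinAt G v H w).edgeSet = Nat.card (G.sum H).edgeSet + 1 := by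
    rw [h1]
    exact Set.ncard_insert_of_notMem (by simp)
  rw [h2, Nat.card_congr SimpleGraph.edgeSetSumEquiv, Nat.card_sum, Nat.card_sum]
  omega

/-- Joining by an edge respects isomorphism. -/
def joinAtCongr {G : SimpleGraph V} {G' : SimpleGraph V'} {H : SimpleGraph W} {H' : SimpleGraph W'}
    {v : V} {v' : V'} {w : W} {w' : W'} (e : G ≃g G') (he : e v = v') (f : H ≃g H')
    (hf : f w = w') : joinAt G v H w ≃g joinAt G' v' H' w' where
  toEquiv := Equiv.sumCongr e.toEquiv f.toEquiv
  map_rel_iff' := by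
    subst he hf
    rintro (a | a) (b | b)
    · simpa using e.map_adj_iff
    · simp
    · simp
    · simpa using f.map_adj_iff

/-- Two joins at a graph may be interchanged. -/
def joinAtSwap (G : SimpleGraph V) (a b : V) (H : SimpleGraph W) (w : W) (K : SimpleGraph U)
    (u : U) :
    joinAt (joinAt G a H w) (Sum.inl b) K u ≃g joinAt (joinAt G b K u) (Sum.inl a) H w where
  toEquiv :=
    { toFun := Sum.elim (Sum.elim (fun x => Sum.inl (Sum.inl x)) Sum.inr)
        (fun x => Sum.inl (Sum.inr x))
      invFun := Sum.elim (Sum.elim (fun x => Sum.inl (Sum.inl x)) Sum.inr)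
        (fun x => Sum.inl (Sum.inr x))
      left_inv := by rintro ((x | x) | x) <;> rfl
      right_inv := by rintro ((x | x) | x) <;> rfl }
  map_rel_iff' := by
    rintro ((x | x) | x) ((y | y) | y) <;> simp

/-- Joins are associative. -/
def joinAtAssoc (G : SimpleGraph V) (v : V) (H : SimpleGraph W) (w x : W) (K : SimpleGraph U)
    (u : U) :
    joinAt (joinAt G v H w) (Sum.inr x) K u ≃g joinAt G v (joinAt H x K u) (Sum.inl w) where
  toEquiv := Equiv.sumAssoc V W U
  map_rel_iff' := by
    rintro ((x | x) | x) ((y | y) | y) <;> simp [Equiv.sumAssoc]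

/-- A walk from `v` inside `G` has an image starting at `v'`. That image could leave the left part
only through `w'`, which is already the image of `w`. -/
theorem Iso.map_left_of_map_roots {G : SimpleGraph V} {G' : SimpleGraph V'}
    {H : SimpleGraph W}
    {H' : SimpleGraph W'} {v : V} {v' : V'} {w : W} {w' : W'} (hG : G.Connected)
    (σ : joinAt G v H w ≃g joinAt G' v' H' w') (hv : σ (Sum.inl v) = Sum.inl v')
    (hw : σ (Sum.inr w) = Sum.inr w') (a : V) : ∃ a', σ (Sum.inl a) = Sum.inl a' := by
  have key : ∀ a b : V, G.Adj a b → (∃ a', σ (Sum.inl a) = Sum.inl a') →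
      ∃ b', σ (Sum.inl b) = Sum.inl b' := by
    rintro a b hab ⟨a', ha'⟩
    have h := σ.map_adj_iff.2 ((joinAt_inl_inl (v := v) (H := H) (w := w)).2 hab)
    rw [ha'] at h
    rcases hb : σ (Sum.inl b) with b' | b'
    · exact ⟨b', rfl⟩
    · rw [hb, joinAt_inl_inr] at h
      rw [h.2, ← hw] at hb
      simpa using σ.injective hb
  obtain ⟨p⟩ := hG.preconnected v a
  have : ∀ (b c : V) (p : G.Walk b c), (∃ a', σ (Sum.inl b) = Sum.inl a') →
      ∃ a', σ (Sum.inl c) = Sum.inl a' := by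
    intro b c p
    induction p with
    | nil => exact id
    | cons h _ ih => exact fun hb => ih (key _ _ h hb)
  exact this _ _ p ⟨v', hv⟩

theorem Iso.map_right_of_map_roots {G : SimpleGraph V} {G' : SimpleGraph V'}
    {H : SimpleGraph W}
    {H' : SimpleGraph W'} {v : V} {v' : V'} {w : W} {w' : W'} (hH : H.Connected)
    (σ : joinAt G v H w ≃g joinAt G' v' H' w') (hv : σ (Sum.inl v) = Sum.inl v')
    (hw : σ (Sum.inr w) = Sum.inr w') (a : W) : ∃ a', σ (Sum.inr a) = Sum.inr a' := by
  have key : ∀ a b : W, H.Adj a b → (∃ a', σ (Sum.inr a) = Sum.inr a') →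
      ∃ b', σ (Sum.inr b) = Sum.inr b' := by
    rintro a b hab ⟨a', ha'⟩
    have h := σ.map_adj_iff.2 ((joinAt_inr_inr (v := v) (G := G) (w := w)).2 hab)
    rw [ha'] at h
    rcases hb : σ (Sum.inr b) with b' | b'
    · rw [hb, joinAt_inr_inl] at h
      rw [h.1, ← hv] at hb
      simpa using σ.injective hb
    · exact ⟨b', rfl⟩
  have : ∀ (b c : W) (p : H.Walk b c), (∃ a', σ (Sum.inr b) = Sum.inr a') →
      ∃ a', σ (Sum.inr c) = Sum.inr a' := by
    intro b c p
    induction p with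
    | nil => exact id
    | cons h _ ih => exact fun hb => ih (key _ _ h hb)
  obtain ⟨p⟩ := hH.preconnected w a
  exact this _ _ p ⟨w', hw⟩

/-- An isomorphism of joins that preserves the ends of the joining edge restricts to both
parts. -/
theorem exists_iso_of_joinAt_iso {G : SimpleGraph V} {G' : SimpleGraph V'} {H : SimpleGraph W}
    {H' : SimpleGraph W'} {v : V} {v' : V'} {w : W} {w' : W'} (hG : G.Connected)
    (hG' : G'.Connected) (hH : H.Connected) (hH' : H'.Connected)
    (σ : joinAt G v H w ≃g joinAt G' v' H' w') (hv : σ (Sum.inl v) = Sum.inl v')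
    (hw : σ (Sum.inr w) = Sum.inr w') :
    (∃ e : G ≃g G', e v = v') ∧ ∃ f : H ≃g H', f w = w' := by
  have hv' : σ.symm (Sum.inl v') = Sum.inl v := by rw [← hv]; simp
  have hw' : σ.symm (Sum.inr w') = Sum.inr w := by rw [← hw]; simp
  choose e he using Iso.map_left_of_map_roots hG σ hv hw
  choose e' he' using Iso.map_left_of_map_roots hG' σ.symm hv' hw'
  choose f hf using Iso.map_right_of_map_roots hH σ hv hw
  choose f' hf' using Iso.map_right_of_map_roots hH' σ.symm hv' hw'
  refine ⟨⟨⟨⟨e, e', fun a => ?_, fun a => ?_⟩, fun {a b} => ?_⟩, ?_⟩,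
    ⟨⟨⟨f, f', fun a => ?_, fun a => ?_⟩, fun {a b} => ?_⟩, ?_⟩⟩
  · apply Sum.inl_injective (β := W)
    rw [← he', ← he]; simp
  · apply Sum.inl_injective (β := W')
    rw [← he, ← he']; simp
  · change G'.Adj (e a) (e b) ↔ _
    rw [← joinAt_inl_inl (v := v') (H := H') (w := w'), ← he, ← he, σ.map_adj_iff, joinAt_inl_inl]
  · apply Sum.inl_injective (β := W')
    exact (he v).symm.trans hv
  · apply Sum.inr_injective (α := V)
    rw [← hf', ← hf]; simp
  · apply Sum.inr_injective (α := V')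
    rw [← hf, ← hf']; simp
  · change H'.Adj (f a) (f b) ↔ _
    rw [← joinAt_inr_inr (v := v') (G := G') (w := w'), ← hf, ← hf, σ.map_adj_iff, joinAt_inr_inr]
  · apply Sum.inr_injective (α := V')
    exact (hf w).symm.trans hw

end JoinAt

/-! ### Ordered trees as representatives of finite trees. -/

/-- Ordered rooted trees: `graft t s` has the root of `t`, and the root of `s` as an additional
child of it. -/
inductive PlaneTree : Type
  | leaf : PlaneTree
  | graft : PlaneTree → PlaneTree → PlaneTree

namespace PlaneTree

/-- The vertices of an ordered tree. -/
def Vert : PlaneTree → Type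
  | leaf => Unit
  | graft t s => Vert t ⊕ Vert s

/-- The number of vertices. -/
def size : PlaneTree → ℕ
  | leaf => 1
  | graft t s => size t + size s

/-- The root. -/
def root : (t : PlaneTree) → Vert t
  | leaf => ()
  | graft t _ => Sum.inl (root t)

/-- The graph of an ordered tree. -/
def graph : (t : PlaneTree) → SimpleGraph (Vert t)
  | leaf => ⊥
  | graft t s => joinAt (graph t) (root t) (graph s) (root s)

instance instFintypeVert : (t : PlaneTree) → Fintype (Vert t)
  | leaf => inferInstanceAs (Fintype Unit)
  | graft t s =>
    have := instFintypeVert t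
    have := instFintypeVert s
    inferInstanceAs (Fintype (Vert t ⊕ Vert s))

theorem card_vert (t : PlaneTree) : Fintype.card (Vert t) = t.size := by
  induction t with
  | leaf => rfl
  | graft t s ht hs =>
    rw [size, ← ht, ← hs]
    exact Fintype.card_sum

theorem size_pos (t : PlaneTree) : 0 < t.size := by
  induction t with
  | leaf => exact Nat.one_pos
  | graft t s ht hs => exact Nat.add_pos_left ht _

theorem isTree_graph (t : PlaneTree) : (graph t).IsTree := by
  induction t with
  | leaf =>
    have : Subsingleton (Vert leaf) := inferInstanceAs (Subsingleton Unit)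
    have : Nonempty (Vert leaf) := ⟨root leaf⟩
    exact SimpleGraph.IsTree.of_subsingleton
  | graft t s ht hs => exact isTree_joinAt ht _ hs _

/-- Rooted isomorphism. -/
def RootedIso (t s : PlaneTree) : Prop :=
  ∃ e : graph t ≃g graph s, e (root t) = root s

theorem RootedIso.refl (t : PlaneTree) : RootedIso t t := ⟨SimpleGraph.Iso.refl, rfl⟩

theorem RootedIso.symm {t s : PlaneTree} (h : RootedIso t s) : RootedIso s t := by
  obtain ⟨e, he⟩ := h
  exact ⟨e.symm, by rw [← he]; simp⟩

theorem RootedIso.trans {t s r : PlaneTree} (h : RootedIso t s) (h' : RootedIso s r) :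
    RootedIso t r := by
  obtain ⟨e, he⟩ := h
  obtain ⟨f, hf⟩ := h'
  exact ⟨e.trans f, by rw [← hf, ← he]; rfl⟩

theorem RootedIso.graft {t s t' s' : PlaneTree} (h : RootedIso t t') (h' : RootedIso s s') :
    RootedIso (graft t s) (graft t' s') := by
  obtain ⟨e, he⟩ := h
  obtain ⟨f, hf⟩ := h'
  exact ⟨joinAtCongr e he f hf, congrArg Sum.inl he⟩

theorem RootedIso.graft_comm (t a b : PlaneTree) :
    RootedIso (PlaneTree.graft (PlaneTree.graft t a) b)
      (PlaneTree.graft (PlaneTree.graft t b) a) :=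
  ⟨joinAtSwap _ _ _ _ _ _ _, rfl⟩

/-- Swapping and reassociating joins moves the new leaf down to the branch whose root it hangs from.
This supplies the induction step for `exists_graph_iso`. -/
theorem exists_graph_iso_addLeaf (t : PlaneTree) (x : Vert t) :
    ∃ (s : PlaneTree) (e : joinAt (graph t) x (graph leaf) (root leaf) ≃g graph s),
      e (Sum.inl (root t)) = root s := by
  induction t with
  | leaf => exact ⟨graft leaf leaf, SimpleGraph.Iso.refl, rfl⟩
  | graft t s ht hs =>
    rcases x with a | b
    · obtain ⟨t', e, he⟩ := ht a
      exact ⟨graft t' s, (joinAtSwap _ _ _ _ _ _ _).trans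
        (joinAtCongr e he SimpleGraph.Iso.refl rfl), congrArg Sum.inl he⟩
    · obtain ⟨s', e, he⟩ := hs b
      exact ⟨graft t s', (joinAtAssoc _ _ _ _ _ _ _).trans
        (joinAtCongr SimpleGraph.Iso.refl rfl e he), rfl⟩

/-- A graph with a vertex of degree one is a join with a one-vertex graph. -/
theorem exists_iso_joinAt_leaf {V : Type*} (G : SimpleGraph V) {u v : V} (huv : u ≠ v)
    (h : ∀ w, G.Adj v w ↔ w = u) :
    Nonempty (G ≃g joinAt (G.induce {v}ᶜ) ⟨u, huv⟩ (graph leaf) (root leaf)) := by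
  classical
  refine ⟨SimpleGraph.Iso.symm ⟨⟨Sum.elim Subtype.val fun _ => v,
    fun w => if hw : w = v then Sum.inr (root leaf) else Sum.inl ⟨w, hw⟩, ?_, ?_⟩, ?_⟩⟩
  · rintro (⟨w, hw⟩ | w)
    · have hw' : w ≠ v := hw
      simp [hw']
    · simp; rfl
  · intro w
    by_cases hw : w = v <;> simp [hw]
  · rintro (⟨a, ha⟩ | a) (⟨b, hb⟩ | b)
    · simp
    · simp only [Equiv.coe_fn_mk, Sum.elim_inl, Sum.elim_inr, joinAt_inl_inr]
      rw [G.adj_comm, h]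
      exact ⟨fun h => ⟨Subtype.ext h, rfl⟩, fun h => congrArg Subtype.val h.1⟩
    · simp only [Equiv.coe_fn_mk, Sum.elim_inl, Sum.elim_inr, joinAt_inr_inl]
      rw [h]
      exact ⟨fun h => ⟨Subtype.ext h, rfl⟩, fun h => congrArg Subtype.val h.1⟩
    · simp only [Equiv.coe_fn_mk, Sum.elim_inr, SimpleGraph.irrefl, joinAt_inr_inr, false_iff]
      exact fun h => h

/-- Every finite tree is the graph of an ordered tree. -/
theorem exists_graph_iso (n : ℕ) : ∀ {V : Type} [Finite V] (G : SimpleGraph V), G.IsTree →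
    Nat.card V = n → ∃ t : PlaneTree, Nonempty (G ≃g graph t) := by
  induction n with
  | zero =>
    intro V _ G hG hn
    have := hG.connected.nonempty
    exact absurd hn Nat.card_pos.ne'
  | succ n ih =>
    intro V _ G hG hn
    classical
    have := Fintype.ofFinite V
    rcases subsingleton_or_nontrivial V with hV | hV
    · have := hG.connected.nonempty
      have e : V ≃ Unit := Fintype.equivOfCardEq (by
        rw [Fintype.card_unit]
        exact Fintype.card_eq_one_iff.2 ⟨Classical.arbitrary V, fun y => Subsingleton.elim _ _⟩)
      refine ⟨leaf, ⟨⟨e, fun {a b} => ?_⟩⟩⟩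
      rw [Subsingleton.elim a b]
      simp
    · obtain ⟨v, hv⟩ := hG.exists_vert_degree_one_of_nontrivial
      have hT : (G.induce {v}ᶜ).IsTree :=
        ⟨hG.connected.induce_compl_singleton_of_degree_eq_one hv, hG.isAcyclic.induce _⟩
      obtain ⟨u, hu, hu'⟩ := SimpleGraph.degree_eq_one_iff_existsUnique_adj.1 hv
      have hcard : Nat.card ({v}ᶜ : Set V) = n := by
        rw [Nat.card_coe_set_eq, Set.ncard_compl, hn, Set.ncard_singleton, Nat.add_sub_cancel]
      obtain ⟨t, ⟨e⟩⟩ := ih _ hT hcard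
      obtain ⟨f⟩ := exists_iso_joinAt_leaf G (u := u) (v := v) hu.ne.symm
        (fun w => ⟨hu' w, fun h => h ▸ hu⟩)
      obtain ⟨s, g, -⟩ := exists_graph_iso_addLeaf t (e ⟨u, hu.ne.symm⟩)
      exact ⟨s, ⟨(f.trans (joinAtCongr e rfl SimpleGraph.Iso.refl rfl)).trans g⟩⟩

end PlaneTree
-- Matula numbers: rooted trees as positive integers.
/-- The `k`-th prime, counted from one. -/
noncomputable def nthPrime (k : ℕ) : ℕ := Nat.nth Nat.Prime (k - 1)

/-- The number of primes up to a given prime. -/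
def primeIndex (p : ℕ) : ℕ := Nat.count Nat.Prime p + 1

theorem prime_nthPrime (k : ℕ) : (nthPrime k).Prime := Nat.prime_nth_prime _

theorem primeIndex_nthPrime {k : ℕ} (hk : k ≠ 0) : primeIndex (nthPrime k) = k := by
  rw [primeIndex, nthPrime, Nat.count_nth_of_infinite Nat.infinite_setOfPred_prime]
  omega

theorem nthPrime_primeIndex {p : ℕ} (hp : p.Prime) : nthPrime (primeIndex p) = p := by
  rw [primeIndex, nthPrime, Nat.add_sub_cancel, Nat.nth_count hp]

theorem primeIndex_pos (p : ℕ) : primeIndex p ≠ 0 := Nat.succ_ne_zero _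

theorem nthPrime_injOn {k l : ℕ} (hk : k ≠ 0) (hl : l ≠ 0) (h : nthPrime k = nthPrime l) :
    k = l := by
  rw [← primeIndex_nthPrime hk, h, primeIndex_nthPrime hl]

theorem lt_nthPrime (k : ℕ) : k < nthPrime k := by
  have := Nat.add_two_le_nth_prime (k - 1)
  rw [nthPrime]
  omega

theorem primeIndex_lt {p : ℕ} (hp : p.Prime) : primeIndex p < p := by
  conv_rhs => rw [← nthPrime_primeIndex hp]
  exact lt_nthPrime _

/-- The number of edges of the rooted tree with Matula number `n`. -/
def edges (n : ℕ) : ℕ :=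
  (n.primeFactorsList.attach.map fun p => edges (primeIndex p.1) + 1).sum
termination_by n
decreasing_by
  have hp := Nat.prime_of_mem_primeFactorsList p.2
  exact (primeIndex_lt hp).trans_le (Nat.le_of_mem_primeFactorsList p.2)

theorem edges_eq (n : ℕ) :
    edges n = (n.primeFactorsList.map fun p => edges (primeIndex p) + 1).sum := by
  rw [edges]
  rw [List.attach_map_val (l := n.primeFactorsList) (f := fun p => edges (primeIndex p) + 1)]

theorem edges_one : edges 1 = 0 := by
  rw [edges_eq, Nat.primeFactorsList_one]
  rfl

theorem edges_mul {m n : ℕ} (hm : m ≠ 0) (hn : n ≠ 0) : edges (m * n) = edges m + edges n := by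
  rw [edges_eq, edges_eq m, edges_eq n, ← List.sum_append, ← List.map_append]
  exact ((Nat.perm_primeFactorsList_mul hm hn).map _).sum_eq

theorem edges_prime {p : ℕ} (hp : p.Prime) : edges p = edges (primeIndex p) + 1 := by
  rw [edges_eq, Nat.primeFactorsList_prime hp]
  rfl

theorem edges_nthPrime {k : ℕ} (hk : k ≠ 0) : edges (nthPrime k) = edges k + 1 := by
  rw [edges_prime (prime_nthPrime k), primeIndex_nthPrime hk]

namespace PlaneTree

/-- The Matula number of a rooted tree: the product, over the children of the root, of the
primes indexed by their Matula numbers. -/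
noncomputable def matula : PlaneTree → ℕ
  | leaf => 1
  | graft t s => matula t * nthPrime (matula s)

theorem matula_ne_zero (t : PlaneTree) : matula t ≠ 0 := by
  induction t with
  | leaf => exact one_ne_zero
  | graft t s ht hs => exact mul_ne_zero ht (prime_nthPrime _).ne_zero

theorem edges_matula (t : PlaneTree) : edges (matula t) + 1 = t.size := by
  induction t with
  | leaf => rw [matula, edges_one, size]
  | graft t s ht hs =>
    rw [matula, size, edges_mul (matula_ne_zero t) (prime_nthPrime _).ne_zero,
      edges_nthPrime (matula_ne_zero s), ← ht, ← hs]
    omega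

theorem exists_matula_eq {m : ℕ} (hm : m ≠ 0) : ∃ t, matula t = m := by
  induction m using Nat.strong_induction_on with
  | _ m ih =>
    by_cases h1 : m = 1
    · exact ⟨leaf, h1.symm⟩
    have hp := Nat.minFac_prime h1
    obtain ⟨n, hn⟩ := Nat.minFac_dvd m
    have hn0 : n ≠ 0 := by
      rintro rfl
      exact hm (by rw [hn, mul_zero])
    have hnm : n < m := by
      conv_rhs => rw [hn]
      exact lt_mul_of_one_lt_left (Nat.pos_of_ne_zero hn0) hp.one_lt
    obtain ⟨t, ht⟩ := ih n hnm hn0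
    obtain ⟨s, hs⟩ := ih (primeIndex m.minFac)
      ((primeIndex_lt hp).trans_le (Nat.minFac_le (Nat.pos_of_ne_zero hm))) (primeIndex_pos _)
    exact ⟨graft t s, by rw [matula, ht, hs, nthPrime_primeIndex hp, mul_comm, ← hn]⟩

/-- Prime factors correspond to children, and `RootedIso.graft_comm` brings any child to the last
position. This is how unique factorization becomes reordering of children. -/
theorem exists_child_of_nthPrime_dvd {k : ℕ} (hk : k ≠ 0) (s : PlaneTree)
    (h : nthPrime k ∣ matula s) : ∃ s₁ c, matula c = k ∧ RootedIso s (graft s₁ c) ∧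
      matula s = matula s₁ * nthPrime k := by
  induction s with
  | leaf => exact absurd (Nat.dvd_one.1 h) (prime_nthPrime k).ne_one
  | graft s c hs hc =>
    rcases (prime_nthPrime k).dvd_mul.1 h with h | h
    · obtain ⟨s₁, c₁, h1, h2, h3⟩ := hs h
      refine ⟨graft s₁ c, c₁, h1,
        (h2.graft (RootedIso.refl c)).trans (RootedIso.graft_comm _ _ _), ?_⟩
      rw [matula, matula, h3]
      ring
    · have := nthPrime_injOn hk (matula_ne_zero c)
        ((Nat.prime_dvd_prime_iff_eq (prime_nthPrime k) (prime_nthPrime _)).1 h)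
      exact ⟨s, c, this.symm, RootedIso.refl _, by rw [matula, this]⟩

theorem rootedIso_of_matula_eq {t s : PlaneTree} (h : matula t = matula s) : RootedIso t s := by
  induction t generalizing s with
  | leaf =>
    cases s with
    | leaf => exact RootedIso.refl _
    | graft s c =>
      exact absurd (Nat.dvd_one.1 ⟨matula s, by rw [mul_comm]; exact h⟩)
        (prime_nthPrime (matula c)).ne_one
  | graft t c ht hc =>
    obtain ⟨s₁, c₁, h1, h2, h3⟩ := exists_child_of_nthPrime_dvd (matula_ne_zero c) s
      (h ▸ Dvd.intro_left _ rfl)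
    rw [h3, matula] at h
    exact ((ht (Nat.eq_of_mul_eq_mul_right (prime_nthPrime _).pos h)).graft (hc h1.symm)).trans
      h2.symm

theorem exists_child_of_adj_root (s : PlaneTree) (w : Vert s) (h : (graph s).Adj (root s) w) :
    ∃ (s₁ c : PlaneTree) (e : graph s ≃g graph (graft s₁ c)), e (root s) = root (graft s₁ c) ∧
      e w = Sum.inr (root c) ∧ matula s = matula s₁ * nthPrime (matula c) := by
  induction s with
  | leaf => exact absurd h id
  | graft s c hs hc =>
    rcases w with a | b
    · obtain ⟨s₁, c₁, e, h1, h2, h3⟩ := hs a (joinAt_inl_inl.1 h)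
      refine ⟨graft s₁ c, c₁, (joinAtCongr e h1 SimpleGraph.Iso.refl rfl).trans
        (joinAtSwap _ _ _ _ _ _ _), ?_, ?_, ?_⟩
      · exact congrArg (fun x => joinAtSwap (graph s₁) (root s₁) (root s₁) (graph c₁) (root c₁)
          (graph c) (root c) (Sum.inl x)) h1
      · exact congrArg (fun x => joinAtSwap (graph s₁) (root s₁) (root s₁) (graph c₁) (root c₁)
          (graph c) (root c) (Sum.inl x)) h2
      · rw [matula, matula, h3]
        ring
    · have hb := (joinAt_inl_inr.1 h).2
      exact ⟨s, c, SimpleGraph.Iso.refl, rfl, congrArg Sum.inr hb, rfl⟩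

/-- An isomorphism takes the last child of `t` to some child of `s`, which may be assumed last too.
It then preserves both ends of the last joining edge, hence restricts to both parts, and induction
applies. -/
theorem matula_eq_of_rootedIso {t s : PlaneTree} (h : RootedIso t s) : matula t = matula s := by
  induction t generalizing s with
  | leaf =>
    cases s with
    | leaf => rfl
    | graft s c =>
      obtain ⟨e, he⟩ := h
      have := Fintype.card_congr e.toEquiv
      rw [card_vert, card_vert, size, size] at this
      have := size_pos s
      have := size_pos c
      omega
  | graft t c ht hc =>
    obtain ⟨e, he⟩ := h
    have hadj : (graph s).Adj (root s) (e (Sum.inr (root c))) := by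
      rw [← he]
      exact e.map_adj_iff.2 (joinAt_inl_inr.2 ⟨rfl, rfl⟩)
    obtain ⟨s₁, c₁, f, h1, h2, h3⟩ := exists_child_of_adj_root s _ hadj
    obtain ⟨⟨g, hg⟩, ⟨g', hg'⟩⟩ := exists_iso_of_joinAt_iso (isTree_graph t).connected
      (isTree_graph s₁).connected (isTree_graph c).connected (isTree_graph c₁).connected
      (e.trans f) ((congrArg f he).trans h1) h2
    rw [matula, h3, ht ⟨g, hg⟩, hc ⟨g', hg'⟩]

end PlaneTree
-- Characteristic polynomials across a joining edge.
/-- The determinant of two square blocks coupled by a single entry on either side. -/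
theorem det_fromBlocks_single {V W R : Type*} [Fintype V] [Fintype W] [DecidableEq V]
    [DecidableEq W] [CommRing R] (A : Matrix V V R) (B : Matrix W W R) (v : V) (w : W) (α β : R) :
    (Matrix.fromBlocks A (Matrix.single v w α) (Matrix.single w v β) B).det =
      A.det * B.det -
        α * β * ((A.updateRow v (Pi.single v 1)).det * (B.updateRow w (Pi.single w 1)).det) := by
  set M := Matrix.fromBlocks A (Matrix.single v w α) (Matrix.single w v β) B with hM
  set N := M.updateRow (Sum.inl v) (Pi.single (Sum.inr w) 1) with hN
  -- Row `v` is split by linearity. Its first part leaves a block triangular matrix, and its second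
  -- part is `α` times `N`.
  have h1 : M = M.updateRow (Sum.inl v)
      (Sum.elim (A v) (0 : W → R) + α • Pi.single (Sum.inr w) 1) := by
    ext (i | i) (j | j)
    · by_cases hi : i = v
      · subst hi
        simp [hM]
      · simp [hM, Matrix.updateRow_apply, hi]
    · by_cases hi : i = v
      · subst hi
        simp [hM, Matrix.single_apply, Pi.single_apply, eq_comm]
      · simp [hM, Matrix.updateRow_apply, hi]
    · simp [hM, Matrix.updateRow_apply]
    · simp [hM, Matrix.updateRow_apply]
  have h2 : M.updateRow (Sum.inl v) (Sum.elim (A v) (0 : W → R)) =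
      Matrix.fromBlocks A 0 (Matrix.single w v β) B := by
    ext (i | i) (j | j)
    · by_cases hi : i = v
      · subst hi
        simp
      · simp [hM, Matrix.updateRow_apply, hi]
    · by_cases hi : i = v
      · subst hi
        simp
      · simp [hM, Matrix.updateRow_apply, hi, Ne.symm hi]
    · simp [hM, Matrix.updateRow_apply]
    · simp [hM, Matrix.updateRow_apply]
  -- Row `w` is split likewise. The first part gives a block triangular matrix with a zero row. In
  -- the second, exchanging rows `v` and `w` makes the matrix block diagonal, whence the minus sign.
  have h3 : N = N.updateRow (Sum.inr w)
      (Sum.elim (0 : V → R) (B w) + β • Pi.single (Sum.inl v) 1) := by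
    ext (i | i) (j | j)
    · simp [Matrix.updateRow_apply]
    · simp [Matrix.updateRow_apply]
    · by_cases hi : i = w
      · subst hi
        simp [hN, hM, Matrix.updateRow_apply, Matrix.single_apply, Pi.single_apply, eq_comm]
      · simp [Matrix.updateRow_apply, hi]
    · by_cases hi : i = w
      · subst hi
        simp [hN, hM, Matrix.updateRow_apply]
      · simp [Matrix.updateRow_apply, hi]
  have h4 : N.updateRow (Sum.inr w) (Sum.elim (0 : V → R) (B w)) =
      Matrix.fromBlocks (A.updateRow v 0) (Matrix.single v w 1) 0 B := by
    ext (i | i) (j | j)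
    · by_cases hi : i = v
      · subst hi
        simp [hN, Matrix.updateRow_apply]
      · simp [hN, hM, Matrix.updateRow_apply, hi]
    · by_cases hi : i = v
      · subst hi
        simp [hN, Matrix.updateRow_apply, Matrix.single_apply, Pi.single_apply, eq_comm]
      · simp [hN, hM, Matrix.updateRow_apply, hi, Ne.symm hi]
    · by_cases hi : i = w
      · subst hi
        simp
      · simp [hN, hM, Matrix.updateRow_apply, hi, Ne.symm hi]
    · by_cases hi : i = w
      · subst hi
        simp
      · simp [hN, hM, Matrix.updateRow_apply, hi]
  have h5 : N.updateRow (Sum.inr w) (Pi.single (Sum.inl v) 1) =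
      (Matrix.fromBlocks (A.updateRow v (Pi.single v 1)) 0 0
        (B.updateRow w (Pi.single w 1))).submatrix (Equiv.swap (Sum.inl v) (Sum.inr w)) id := by
    ext i j
    by_cases hi : i = Sum.inr w
    · subst hi
      rcases j with j | j <;> simp [Pi.single_apply]
    by_cases hi' : i = Sum.inl v
    · subst hi'
      rcases j with j | j <;> simp [hN, Matrix.updateRow_apply, Pi.single_apply]
    · rw [Matrix.submatrix_apply, Equiv.swap_apply_of_ne_of_ne hi' hi]
      rcases i with i | i
      · have : i ≠ v := fun h => hi' (by rw [h])
        rcases j with j | j <;>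
          simp [hN, hM, Matrix.updateRow_apply, this, Ne.symm this]
      · have : i ≠ w := fun h => hi (by rw [h])
        rcases j with j | j <;>
          simp [hN, hM, Matrix.updateRow_apply, this, Ne.symm this]
  have h6 : (A.updateRow v 0).det = 0 :=
    Matrix.det_eq_zero_of_row_eq_zero v (by simp)
  have h7 : N.det = -(β * ((A.updateRow v (Pi.single v 1)).det *
      (B.updateRow w (Pi.single w 1)).det)) := by
    rw [h3, Matrix.det_updateRow_add, Matrix.det_updateRow_smul, h4, h5,
      Matrix.det_fromBlocks_zero₂₁, h6, Matrix.det_permute, Matrix.det_fromBlocks_zero₂₁,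
      Equiv.Perm.sign_swap (by simp)]
    simp
  rw [h1, Matrix.det_updateRow_add, Matrix.det_updateRow_smul, h2, ← hN, h7,
    Matrix.det_fromBlocks_zero₁₂]
  ring

section PartialCharpoly

variable {V W : Type*}

open Classical Polynomial in
/-- The matrix `X I - A` with the rows of `K` replaced by those of the identity matrix. -/
noncomputable def delMatrix (G : SimpleGraph V) (K : Set V) : Matrix V V ℤ[X] := fun i j =>
  if i ∈ K then (if i = j then 1 else 0)
  else (if i = j then X else 0) - (if G.Adj i j then 1 else 0)

open Classical Polynomial in
/-- The characteristic polynomial of the graph obtained by deleting the vertices in `K`. -/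
noncomputable def delPoly [Fintype V] (G : SimpleGraph V) (K : Set V) : ℤ[X] :=
  (delMatrix G K).det

open Classical Polynomial in
/-- The characteristic polynomial after the deletion of `K` and of `v ∉ K`; zero for `v ∈ K`. -/
noncomputable def delRootPoly [Fintype V] (G : SimpleGraph V) (v : V) (K : Set V) : ℤ[X] :=
  if v ∈ K then 0 else delPoly G (insert v K)

open Classical Polynomial in
theorem delMatrix_updateRow (G : SimpleGraph V) (K : Set V) (v : V) :
    (delMatrix G K).updateRow v (Pi.single v 1) = delMatrix G (insert v K) := by
  ext1 i j
  rw [Matrix.updateRow_apply]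
  by_cases hi : i = v
  · subst hi
    simp [delMatrix, Pi.single_apply, eq_comm]
  · simp [delMatrix, hi]

open Classical Polynomial in
theorem delPoly_joinAt [Fintype V] [Fintype W] (G : SimpleGraph V) (v : V) (H : SimpleGraph W)
    (w : W) (K : Set (V ⊕ W)) :
    delPoly (joinAt G v H w) K =
      delPoly G (Sum.inl ⁻¹' K) * delPoly H (Sum.inr ⁻¹' K) -
        delRootPoly G v (Sum.inl ⁻¹' K) * delRootPoly H w (Sum.inr ⁻¹' K) := by
  -- The coupling entries vanish as soon as an end of the edge lies in `K`. This matches the value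
  -- zero of `delRootPoly` there.
  have h : delMatrix (joinAt G v H w) K =
      Matrix.fromBlocks (delMatrix G (Sum.inl ⁻¹' K))
        (Matrix.single v w (if Sum.inl v ∈ K then 0 else -1))
        (Matrix.single w v (if Sum.inr w ∈ K then 0 else -1))
        (delMatrix H (Sum.inr ⁻¹' K)) := by
    ext1 (i | i) (j | j)
    · simp [delMatrix]
    · by_cases hi : i = v
      · subst hi
        by_cases hj : j = w
        · subst hj
          by_cases hK : Sum.inl i ∈ K <;> simp [delMatrix, hK]
        · simp [delMatrix, hj, Ne.symm hj]
      · simp [delMatrix, hi, Ne.symm hi]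
    · by_cases hi : i = w
      · subst hi
        by_cases hj : j = v
        · subst hj
          by_cases hK : Sum.inr i ∈ K <;> simp [delMatrix, hK]
        · simp [delMatrix, hj, Ne.symm hj]
      · simp [delMatrix, hi, Ne.symm hi]
    · simp [delMatrix]
  have h0 := det_fromBlocks_single (delMatrix G (Sum.inl ⁻¹' K)) (delMatrix H (Sum.inr ⁻¹' K)) v w
    (if Sum.inl v ∈ K then 0 else -1) (if Sum.inr w ∈ K then 0 else -1)
  rw [delMatrix_updateRow, delMatrix_updateRow, ← h] at h0
  refine Eq.trans (b := (delMatrix (joinAt G v H w) K).det) ?_ (h0.trans ?_)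
  · rw [delPoly]
    convert rfl
  by_cases h1 : Sum.inl v ∈ K <;> by_cases h2 : Sum.inr w ∈ K <;>
    simp [delRootPoly, h1, h2, delPoly]

theorem delRootPoly_joinAt [Fintype V] [Fintype W] (G : SimpleGraph V) (v : V)
    (H : SimpleGraph W) (w : W) (K : Set (V ⊕ W)) :
    delRootPoly (joinAt G v H w) (Sum.inl v) K =
      delRootPoly G v (Sum.inl ⁻¹' K) * delPoly H (Sum.inr ⁻¹' K) := by
  by_cases h : Sum.inl v ∈ K
  · simp [delRootPoly, h]
  · have h1 : Sum.inl ⁻¹' (insert (Sum.inl v) K) = insert v (Sum.inl ⁻¹' K : Set V) := by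
      ext; simp
    have h2 : Sum.inr ⁻¹' (insert (Sum.inl v) K) = (Sum.inr ⁻¹' K : Set W) := by
      ext; simp
    rw [delRootPoly, if_neg h, delPoly_joinAt, h1, h2]
    simp [delRootPoly, h]

theorem det_eq_one_of_subsingleton {n R : Type*} [CommRing R] [Subsingleton n]
    (d : DecidableEq n) (f : Fintype n) (M : Matrix n n R) (h : ∀ i, M i i = 1) : M.det = 1 := by
  have : M = 1 := by
    ext i j
    rw [Subsingleton.elim j i, h, Matrix.one_apply_eq]
  rw [this, Matrix.det_one]

/-- Row `u` is a row of the identity, so the matrix is block triangular. The block at `u`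
contributes `1` and the other block is the characteristic matrix of `G \ u`. -/
theorem charPoly_deleteVertex [Fintype V] (G : SimpleGraph V) (u : V)
    [Fintype {w : V // w ≠ u}] : charPoly (deleteVertex G u) = delPoly G {u} := by
  classical
  rw [delPoly, Matrix.twoBlockTriangular_det' _ (fun i => i = u)]
  · have h2 : (delMatrix G {u}).toSquareBlockProp (fun i => ¬ i = u) =
        ((deleteVertex G u).adjMatrix ℤ).charmatrix := by
      ext1 ⟨i, hi⟩ ⟨j, hj⟩
      have hA : (deleteVertex G u).adjMatrix ℤ ⟨i, hi⟩ ⟨j, hj⟩ = if G.Adj i j then 1 else 0 := by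
        rw [SimpleGraph.adjMatrix_apply]
        convert rfl
        exact Iff.rfl
      have hi' : i ∉ ({u} : Set V) := hi
      rw [Matrix.charmatrix_apply, hA, Matrix.diagonal_apply]
      change delMatrix G {u} i j = _
      rw [delMatrix, if_neg hi']
      by_cases hadj : G.Adj i j <;> simp [hadj]
    refine ((congrArg₂ (· * ·) (?_ : _ = (1 : Polynomial ℤ))
      (?_ : _ = charPoly (deleteVertex G u))).trans (one_mul _)).symm
    · refine det_eq_one_of_subsingleton _ _ _ ?_
      rintro ⟨i, rfl⟩
      simp [delMatrix, Matrix.toSquareBlockProp]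
    · rw [h2]
      unfold charPoly Matrix.charpoly
      convert rfl
  · rintro i rfl j hj
    simp [delMatrix, Ne.symm hj]

end PartialCharpoly

/-! ### Distances and transmissions in joins. -/

section Transmission

variable {V W : Type*}

theorem le_add_length_of_walk {G : SimpleGraph V} (f : V → ℕ)
    (hf : ∀ x y, G.Adj x y → f y ≤ f x + 1) {x y : V} (p : G.Walk x y) :
    f y ≤ f x + p.length := by
  induction p with
  | nil => simp
  | cons h p ih =>
    have := hf _ _ h
    rw [SimpleGraph.Walk.length_cons]
    omega

theorem dist_le_of_hom {G : SimpleGraph V} {H : SimpleGraph W} (hG : G.Connected) (f : G →g H)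
    (a b : V) : H.dist (f a) (f b) ≤ G.dist a b := by
  obtain ⟨p, hp⟩ := hG.exists_walk_length_eq_dist a b
  rw [← hp, ← SimpleGraph.Walk.length_map f]
  exact SimpleGraph.dist_le _

theorem dist_iso {G : SimpleGraph V} {H : SimpleGraph W} (hG : G.Connected) (e : G ≃g H)
    (a b : V) : H.dist (e a) (e b) = G.dist a b := by
  refine le_antisymm (dist_le_of_hom hG e.toHom a b) ?_
  have := dist_le_of_hom (e.connected_iff.1 hG) e.symm.toHom (e a) (e b)
  simpa using this

/-- The expected distance function vanishes at `inl a` and grows by at most one along each edge. It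
is therefore a lower bound for the length of every walk. -/
theorem dist_joinAt_aux {G : SimpleGraph V} {H : SimpleGraph W} (hG : G.Connected)
    (hH : H.Connected) (v : V) (w : W) (a : V) (x : V ⊕ W) :
    Sum.elim (G.dist a) (fun b => G.dist a v + 1 + H.dist w b) x ≤
      (joinAt G v H w).dist (Sum.inl a) x := by
  have hJ : (joinAt G v H w).Connected := hG.sum_sup_edge hH
  obtain ⟨p, hp⟩ := hJ.exists_walk_length_eq_dist (Sum.inl a) x
  have := le_add_length_of_walk
    (Sum.elim (G.dist a) (fun b => G.dist a v + 1 + H.dist w b)) (by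
      rintro (x | x) (y | y) h
      · have := hG.dist_triangle (u := a) (v := x) (w := y)
        rw [SimpleGraph.dist_eq_one_iff_adj.2 (joinAt_inl_inl.1 h)] at this
        simpa using this
      · obtain ⟨rfl, rfl⟩ := joinAt_inl_inr.1 h
        simp
      · obtain ⟨rfl, rfl⟩ := joinAt_inr_inl.1 h
        simp
        omega
      · have := hH.dist_triangle (u := w) (v := x) (w := y)
        rw [SimpleGraph.dist_eq_one_iff_adj.2 (joinAt_inr_inr.1 h)] at this
        simp
        omega) p
  rw [← hp]
  simpa using this

theorem dist_joinAt_inl_inl {G : SimpleGraph V} {H : SimpleGraph W} (hG : G.Connected)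
    (hH : H.Connected) (v : V) (w : W) (a b : V) :
    (joinAt G v H w).dist (Sum.inl a) (Sum.inl b) = G.dist a b :=
  le_antisymm (dist_le_of_hom hG (⟨Sum.inl, joinAt_inl_inl.2⟩ : G →g joinAt G v H w) a b)
    (dist_joinAt_aux hG hH v w a (Sum.inl b))

theorem dist_joinAt_inl_inr {G : SimpleGraph V} {H : SimpleGraph W} (hG : G.Connected)
    (hH : H.Connected) (v : V) (w : W) (a : V) (b : W) :
    (joinAt G v H w).dist (Sum.inl a) (Sum.inr b) = G.dist a v + 1 + H.dist w b := by
  refine le_antisymm ?_ (dist_joinAt_aux hG hH v w a (Sum.inr b))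
  have hJ : (joinAt G v H w).Connected := hG.sum_sup_edge hH
  have h1 := dist_le_of_hom hG (⟨Sum.inl, joinAt_inl_inl.2⟩ : G →g joinAt G v H w) a v
  have h2 := dist_le_of_hom hH (⟨Sum.inr, joinAt_inr_inr.2⟩ : H →g joinAt G v H w) w b
  have h3 : (joinAt G v H w).dist (Sum.inl v) (Sum.inr w) = 1 :=
    SimpleGraph.dist_eq_one_iff_adj.2 (joinAt_inl_inr.2 ⟨rfl, rfl⟩)
  have h4 := hJ.dist_triangle (u := Sum.inl a) (v := Sum.inl v) (w := Sum.inr w)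
  have h5 := hJ.dist_triangle (u := Sum.inl a) (v := Sum.inr w) (w := Sum.inr b)
  simp only [RelHom.coeFn_mk] at h1 h2
  omega

/-- Joins are commutative. -/
def joinAtComm (G : SimpleGraph V) (v : V) (H : SimpleGraph W) (w : W) :
    joinAt G v H w ≃g joinAt H w G v where
  toEquiv := Equiv.sumComm V W
  map_rel_iff' := by
    rintro (a | a) (b | b) <;> simp [and_comm]

/-- The sum of the distances from a vertex. -/
noncomputable def transmission [Fintype V] (G : SimpleGraph V) (a : V) : ℕ := ∑ b, G.dist a b

theorem transmission_iso [Fintype V] [Fintype W] {G : SimpleGraph V} {H : SimpleGraph W}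
    (hG : G.Connected) (e : G ≃g H) (a : V) : transmission H (e a) = transmission G a := by
  rw [transmission, transmission, ← e.toEquiv.sum_comp]
  exact Finset.sum_congr rfl fun b _ => dist_iso hG e a b

theorem transmission_joinAt_inl [Fintype V] [Fintype W] {G : SimpleGraph V} {H : SimpleGraph W}
    (hG : G.Connected) (hH : H.Connected) (v : V) (w : W) (a : V) :
    transmission (joinAt G v H w) (Sum.inl a) =
      transmission G a + (G.dist a v + 1) * Fintype.card W + transmission H w := by
  simp only [transmission, Fintype.sum_sum_type, dist_joinAt_inl_inl hG hH,
    dist_joinAt_inl_inr hG hH, Finset.sum_add_distrib, Finset.sum_const, Finset.card_univ,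
    smul_eq_mul]
  ring

theorem transmission_joinAt_inr [Fintype V] [Fintype W] {G : SimpleGraph V} {H : SimpleGraph W}
    (hG : G.Connected) (hH : H.Connected) (v : V) (w : W) (b : W) :
    transmission (joinAt G v H w) (Sum.inr b) =
      transmission H b + (H.dist b w + 1) * Fintype.card V + transmission G v := by
  have hJ : (joinAt G v H w).Connected := hG.sum_sup_edge hH
  rw [← transmission_iso hJ (joinAtComm G v H w)]
  exact transmission_joinAt_inl hH hG w v b

end Transmission

/-! ### Limbs: existence for every `k`. -/

namespace PlaneTree

/-- The depth of a vertex. -/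
noncomputable def depth (t : PlaneTree) (y : Vert t) : ℕ := (graph t).dist y (root t)

theorem connected_graph (t : PlaneTree) : (graph t).Connected := (isTree_graph t).connected

/-- The inclusion of the vertices of `t` into those of `graft t s`. -/
def inLeft {t : PlaneTree} (s : PlaneTree) (y : Vert t) : Vert (graft t s) := Sum.inl y

/-- The inclusion of the vertices of `s` into those of `graft t s`. -/
def inRight (t : PlaneTree) {s : PlaneTree} (y : Vert s) : Vert (graft t s) := Sum.inr y

theorem inLeft_injective {t : PlaneTree} (s : PlaneTree) :
    Function.Injective (inLeft s (t := t)) := Sum.inl_injective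

theorem inRight_injective (t : PlaneTree) {s : PlaneTree} :
    Function.Injective (inRight t (s := s)) := Sum.inr_injective

theorem depth_root (t : PlaneTree) : depth t (root t) = 0 := SimpleGraph.dist_self

theorem depth_inLeft {t s : PlaneTree} (y : Vert t) : depth (graft t s) (inLeft s y) = depth t y :=
  dist_joinAt_inl_inl (connected_graph t) (connected_graph s) _ _ _ _

theorem depth_inRight {t s : PlaneTree} (y : Vert s) :
    depth (graft t s) (inRight t y) = depth s y + 1 := by
  have h := dist_joinAt_inl_inr (connected_graph t) (connected_graph s) (root t) (root s)
    (root t) y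
  rw [SimpleGraph.dist_self, SimpleGraph.dist_comm, SimpleGraph.dist_comm (u := root s),
    zero_add, add_comm] at h
  exact h

/-- The transmission of a vertex of a tree. -/
noncomputable def distSum (t : PlaneTree) (y : Vert t) : ℕ := transmission (graph t) y

theorem distSum_inLeft {t s : PlaneTree} (y : Vert t) :
    distSum (graft t s) (inLeft s y) =
      distSum t y + (depth t y + 1) * s.size + distSum s (root s) := by
  rw [← card_vert]
  exact transmission_joinAt_inl (connected_graph t) (connected_graph s) _ _ _

theorem distSum_inRight {t s : PlaneTree} (y : Vert s) :
    distSum (graft t s) (inRight t y) =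
      distSum s y + (depth s y + 1) * t.size + distSum t (root t) := by
  rw [← card_vert]
  exact transmission_joinAt_inr (connected_graph t) (connected_graph s) _ _ _

theorem distSum_root {t s : PlaneTree} :
    distSum (graft t s) (root (graft t s)) =
      distSum t (root t) + s.size + distSum s (root s) := by
  refine (distSum_inLeft (root t)).trans ?_
  rw [depth_root, zero_add, one_mul]

open Polynomial

/-- The characteristic polynomial of a tree. -/
noncomputable def poly (t : PlaneTree) : ℤ[X] := delPoly (graph t) ∅

/-- The characteristic polynomial of a tree without its root. -/
noncomputable def rootPoly (t : PlaneTree) : ℤ[X] := delRootPoly (graph t) (root t) ∅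

/-- The characteristic polynomial of a vertex-deleted tree. -/
noncomputable def vertPoly (t : PlaneTree) (y : Vert t) : ℤ[X] := delPoly (graph t) {y}

/-- The characteristic polynomial of a vertex-deleted tree without its root; zero if the
deleted vertex is the root. -/
noncomputable def vertRootPoly (t : PlaneTree) (y : Vert t) : ℤ[X] :=
  delRootPoly (graph t) (root t) {y}

theorem poly_graft (t s : PlaneTree) :
    poly (graft t s) = poly t * poly s - rootPoly t * rootPoly s :=
  delPoly_joinAt _ _ _ _ _

theorem rootPoly_graft (t s : PlaneTree) : rootPoly (graft t s) = rootPoly t * poly s :=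
  delRootPoly_joinAt _ _ _ _ _

theorem preimage_inl_inl {V W : Type*} (y : V) : Sum.inl ⁻¹' {(Sum.inl y : V ⊕ W)} = {y} := by
  ext; simp

theorem preimage_inr_inl {V W : Type*} (y : V) : Sum.inr ⁻¹' {(Sum.inl y : V ⊕ W)} = ∅ := by
  ext; simp

theorem preimage_inl_inr {V W : Type*} (y : W) : Sum.inl ⁻¹' {(Sum.inr y : V ⊕ W)} = ∅ := by
  ext; simp

theorem preimage_inr_inr {V W : Type*} (y : W) : Sum.inr ⁻¹' {(Sum.inr y : V ⊕ W)} = {y} := by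
  ext; simp

theorem vertPoly_inLeft (t s : PlaneTree) (y : Vert t) :
    vertPoly (graft t s) (inLeft s y) = vertPoly t y * poly s - vertRootPoly t y * rootPoly s := by
  have h := delPoly_joinAt (graph t) (root t) (graph s) (root s) {Sum.inl y}
  rw [preimage_inl_inl, preimage_inr_inl] at h
  exact h

theorem vertRootPoly_inLeft (t s : PlaneTree) (y : Vert t) :
    vertRootPoly (graft t s) (inLeft s y) = vertRootPoly t y * poly s := by
  have h := delRootPoly_joinAt (graph t) (root t) (graph s) (root s) {Sum.inl y}
  rw [preimage_inl_inl, preimage_inr_inl] at h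
  exact h

theorem vertPoly_inRight (t s : PlaneTree) (y : Vert s) :
    vertPoly (graft t s) (inRight t y) = poly t * vertPoly s y - rootPoly t * vertRootPoly s y := by
  have h := delPoly_joinAt (graph t) (root t) (graph s) (root s) {Sum.inr y}
  rw [preimage_inl_inr, preimage_inr_inr] at h
  exact h

theorem vertRootPoly_inRight (t s : PlaneTree) (y : Vert s) :
    vertRootPoly (graft t s) (inRight t y) = rootPoly t * vertPoly s y := by
  have h := delRootPoly_joinAt (graph t) (root t) (graph s) (root s) {Sum.inr y}
  rw [preimage_inl_inr, preimage_inr_inr] at h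
  exact h

/-- A tree has `k` vertices at the same depth that are cospectral in every tree having it as a
branch, and whose transmissions in such a tree are different. -/
def HasLimbVertices (k : ℕ) (t : PlaneTree) : Prop :=
  ∃ S : Finset (Vert t), S.card = k ∧ ∃ (d : ℕ) (p q : ℤ[X]),
    (∀ y ∈ S, depth t y = d ∧ vertPoly t y = p ∧ vertRootPoly t y = q) ∧
    Set.InjOn (distSum t) S

theorem HasLimbVertices.mono {k l : ℕ} (h : k ≤ l) {t : PlaneTree} (ht : HasLimbVertices l t) :
    HasLimbVertices k t := by
  obtain ⟨S, hS, d, p, q, hy, hi⟩ := ht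
  obtain ⟨T, hTS, hT⟩ := Finset.exists_subset_card_eq (hS ▸ h)
  exact ⟨T, hT, d, p, q, fun y hyT => hy y (hTS hyT), hi.mono hTS⟩

/-- The new polynomials depend only on the old pair `p`, `q`, and the shift in transmission only on
the common depth `d`. -/
theorem HasLimbVertices.graft_right {k : ℕ} {s : PlaneTree} (hs : HasLimbVertices k s)
    (t : PlaneTree) : HasLimbVertices k (graft t s) := by
  obtain ⟨S, hS, d, p, q, hy, hi⟩ := hs
  refine ⟨S.map ⟨inRight t, inRight_injective t⟩, by rw [Finset.card_map, hS],
    d + 1, poly t * p - rootPoly t * q, rootPoly t * p, ?_, ?_⟩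
  · intro y' hyS'
    obtain ⟨y, hyS, rfl⟩ := Finset.mem_map.1 hyS'
    obtain ⟨h1, h2, h3⟩ := hy y hyS
    refine ⟨(depth_inRight y).trans (by rw [h1]), (vertPoly_inRight t s y).trans ?_,
      (vertRootPoly_inRight t s y).trans ?_⟩
    · rw [h2, h3]
    · rw [h2]
  · intro x' hx' y' hyS' hxy
    obtain ⟨x, hx, rfl⟩ := Finset.mem_map.1 hx'
    obtain ⟨y, hyS, rfl⟩ := Finset.mem_map.1 hyS'
    have := (distSum_inRight (t := t) x).symm.trans (hxy.trans (distSum_inRight y))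
    rw [(hy x hx).1, (hy y hyS).1] at this
    exact congrArg (inRight t) (hi hx hyS (by omega))

theorem HasLimbVertices.hasCospectralNonsimilar {k : ℕ} {t : PlaneTree}
    (ht : HasLimbVertices k t) : HasCospectralNonsimilar k (graph t) := by
  obtain ⟨S, hS, d, p, q, hy, hi⟩ := ht
  refine ⟨S, hS, fun u hu v hv huv => ⟨?_, ?_⟩⟩
  · rw [CospectralVertices, charPoly_deleteVertex, charPoly_deleteVertex]
    exact (hy u hu).2.1.trans (hy v hv).2.1.symm
  · rintro ⟨σ, rfl⟩
    exact huv (hi hu hv (transmission_iso (connected_graph t) σ u).symm)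

/-- A tree whose root has two branches that contain copies of `X`, at a pair of vertices that are
cospectral whatever is attached to the root. -/
def doubling (Y X : PlaneTree) : PlaneTree :=
  graft (graft Y (graft (graft X (graft Y (graft Y Y))) (graft Y (graft Y Y))))
    (graft (graft X Y) (graft (graft Y Y) Y))

/-- The first copy of `X` in `doubling Y X`. -/
def doublingLeft (Y : PlaneTree) {X : PlaneTree} (y : Vert X) : Vert (doubling Y X) :=
  inLeft _ (inRight _ (inLeft _ (inLeft _ y)))

/-- The second copy of `X` in `doubling Y X`. -/
def doublingRight (Y : PlaneTree) {X : PlaneTree} (y : Vert X) : Vert (doubling Y X) :=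
  inRight _ (inLeft _ (inLeft _ y))

/-- The recursions turn both sides into polynomials in `poly` and `rootPoly` of `X` and `Y` and the
two polynomials of the marked vertex. The shape of `doubling` makes them identically equal, so `Y`
remains free. -/
theorem vertPoly_doubling (Y : PlaneTree) {X : PlaneTree} {x y : Vert X}
    (h1 : vertPoly X x = vertPoly X y) (h2 : vertRootPoly X x = vertRootPoly X y) :
    vertPoly (doubling Y X) (doublingLeft Y x) = vertPoly (doubling Y X) (doublingRight Y y) := by
  simp only [doubling, doublingLeft, doublingRight, vertPoly_inLeft, vertPoly_inRight,
    vertRootPoly_inLeft, vertRootPoly_inRight, poly_graft, rootPoly_graft, h1, h2]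
  ring

theorem vertRootPoly_doubling (Y : PlaneTree) {X : PlaneTree} {x y : Vert X}
    (h1 : vertPoly X x = vertPoly X y) (h2 : vertRootPoly X x = vertRootPoly X y) :
    vertRootPoly (doubling Y X) (doublingLeft Y x) =
      vertRootPoly (doubling Y X) (doublingRight Y y) := by
  simp only [doubling, doublingLeft, doublingRight, vertPoly_inLeft, vertRootPoly_inLeft,
    vertRootPoly_inRight, poly_graft, rootPoly_graft, h1, h2]
  ring

theorem exists_size_gt (n : ℕ) : ∃ t : PlaneTree, n < t.size := by
  induction n with
  | zero => exact ⟨leaf, Nat.one_pos⟩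
  | succ n ih =>
    obtain ⟨t, ht⟩ := ih
    exact ⟨graft t leaf, Nat.succ_lt_succ ht⟩

theorem HasLimbVertices.exists_double {k : ℕ} {X : PlaneTree} (hX : HasLimbVertices k X) :
    ∃ t, HasLimbVertices (2 * k) t := by
  classical
  obtain ⟨S, hS, d, p, q, hy, hi⟩ := hX
  -- With `Y` this large, every transmission in the right copy of `X` exceeds every one in the left
  -- copy.
  obtain ⟨Y, hY⟩ := exists_size_gt (∑ y ∈ S, distSum X y)
  obtain ⟨c, hl, hr⟩ : ∃ c, (∀ y ∈ S, distSum (doubling Y X) (doublingLeft Y y) =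
      distSum X y + c) ∧ (∀ y ∈ S,
      distSum (doubling Y X) (doublingRight Y y) =
        distSum X y + c + 4 * Y.size) := by
    -- There are eleven copies of `Y`. The distances to their roots sum to 27 from the root of the
    -- left copy of `X` and to 31 from the root of the right one. The difference gives the term `4 *
    -- Y.size`.
    refine ⟨d * (11 * Y.size + X.size) + 27 * Y.size + 2 * X.size +
      11 * distSum Y (root Y) + distSum X (root X), ?_, ?_⟩ <;>
    · intro y hyS
      simp only [doubling, doublingLeft, doublingRight, distSum_inLeft, distSum_inRight,
        depth_inLeft, depth_inRight, size, (hy y hyS).1, distSum_root]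
      ring
  have hlt : ∀ y ∈ S, distSum X y < Y.size := fun y hyS =>
    (Finset.single_le_sum (f := fun y => distSum X y)
      (fun _ _ => Nat.zero_le _) hyS).trans_lt hY
  have hL : Function.Injective (doublingLeft Y (X := X)) := fun x y h =>
    inLeft_injective _ (inLeft_injective _ (inRight_injective _ (inLeft_injective _ h)))
  have hR : Function.Injective (doublingRight Y (X := X)) := fun x y h =>
    inLeft_injective _ (inLeft_injective _ (inRight_injective _ h))
  refine ⟨doubling Y X, S.image (doublingLeft Y) ∪ S.image (doublingRight Y), ?_, ?_⟩
  · rw [Finset.card_union_of_disjoint, Finset.card_image_of_injective _ hL,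
      Finset.card_image_of_injective _ hR, hS, two_mul]
    rw [Finset.disjoint_left]
    rintro _ h1 h2
    obtain ⟨x, -, rfl⟩ := Finset.mem_image.1 h1
    obtain ⟨y, -, h⟩ := Finset.mem_image.1 h2
    cases h
  -- A vertex `z` of `S` is needed to name the common polynomials.
  rcases S.eq_empty_or_nonempty with rfl | ⟨z, hz⟩
  · exact ⟨0, 0, 0, by simp, by simp⟩
  refine ⟨d + 1, vertPoly (doubling Y X) (doublingRight Y z),
    vertRootPoly (doubling Y X) (doublingRight Y z), ?_, ?_⟩
  · have hlr : ∀ y ∈ S, vertPoly X y = vertPoly X z ∧ vertRootPoly X y = vertRootPoly X z :=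
      fun y hyS => ⟨(hy y hyS).2.1.trans (hy z hz).2.1.symm,
        (hy y hyS).2.2.trans (hy z hz).2.2.symm⟩
    intro y' hyS'
    rcases Finset.mem_union.1 hyS' with h | h <;> obtain ⟨y, hyS, rfl⟩ := Finset.mem_image.1 h <;>
      obtain ⟨e1, e2⟩ := hlr y hyS
    · refine ⟨?_, vertPoly_doubling Y e1 e2, vertRootPoly_doubling Y e1 e2⟩
      simp only [doubling, doublingLeft, depth_inLeft, depth_inRight, (hy y hyS).1]
    · refine ⟨?_, (vertPoly_doubling Y e1.symm e2.symm).symm.trans (vertPoly_doubling Y rfl rfl),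
        (vertRootPoly_doubling Y e1.symm e2.symm).symm.trans (vertRootPoly_doubling Y rfl rfl)⟩
      simp only [doubling, doublingRight, depth_inLeft, depth_inRight, (hy y hyS).1]
  · intro x' hx' y' hyS' hxy
    rcases Finset.mem_union.1 hx' with h | h <;> obtain ⟨x, hxS, rfl⟩ := Finset.mem_image.1 h <;>
      rcases Finset.mem_union.1 hyS' with h' | h' <;>
      obtain ⟨y, hyS, rfl⟩ := Finset.mem_image.1 h' <;>
      have := hlt x hxS <;> have := hlt y hyS
    · rw [hl x hxS, hl y hyS] at hxy
      rw [hi hxS hyS (by omega)]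
    · rw [hl x hxS, hr y hyS] at hxy
      omega
    · rw [hr x hxS, hl y hyS] at hxy
      omega
    · rw [hr x hxS, hr y hyS] at hxy
      rw [hi hxS hyS (by omega)]

theorem exists_hasLimbVertices (k : ℕ) : ∃ t, HasLimbVertices k t := by
  have h : ∀ j : ℕ, ∃ t, HasLimbVertices (2 ^ j) t := by
    intro j
    induction j with
    | zero =>
      exact ⟨leaf, {root leaf}, rfl, _, _, _,
        fun y hy => by rw [Finset.mem_singleton.1 hy]; exact ⟨rfl, rfl, rfl⟩, by simp⟩
    | succ j ih =>
      obtain ⟨t, ht⟩ := ih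
      rw [pow_succ']
      exact ht.exists_double
  obtain ⟨t, ht⟩ := h k
  exact ⟨t, ht.mono Nat.lt_two_pow_self.le⟩

end PlaneTree

/-! ### The generating function of rooted trees and its radius of convergence. -/

open Finset

/-- The term of the generating function of rooted trees belonging to a Matula number. -/
noncomputable def treeTerm (x : ℝ) (k : ℕ) : ℝ := if k = 0 then 0 else x ^ (edges k + 1)

/-- The logarithm of a geometric series without its linear term. -/
noncomputable def logTail (w : ℝ) : ℝ := -Real.log (1 - w) - w

/-- The multiplicative function `m ↦ x ^ edges m`. -/
noncomputable def powEdges (x : ℝ) : ℕ →* ℝ where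
  toFun m := if m = 0 then 0 else x ^ edges m
  map_one' := by simp [edges_one]
  map_mul' m n := by
    by_cases hm : m = 0
    · simp [hm]
    by_cases hn : n = 0
    · simp [hn]
    simp [hm, hn, edges_mul hm hn, pow_add]

theorem powEdges_apply {x : ℝ} {m : ℕ} (hm : m ≠ 0) : powEdges x m = x ^ edges m := if_neg hm

theorem treeTerm_of_ne_zero {x : ℝ} {m : ℕ} (hm : m ≠ 0) : treeTerm x m = x ^ (edges m + 1) :=
  if_neg hm

theorem treeTerm_eq (x : ℝ) (m : ℕ) : treeTerm x m = x * powEdges x m := by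
  by_cases hm : m = 0
  · simp [treeTerm, hm, powEdges]
  · rw [treeTerm_of_ne_zero hm, powEdges_apply hm, pow_succ']

theorem powEdges_nthPrime {x : ℝ} {k : ℕ} (hk : k ≠ 0) :
    powEdges x (nthPrime k) = treeTerm x k := by
  rw [powEdges_apply (prime_nthPrime k).ne_zero, edges_nthPrime hk, treeTerm_of_ne_zero hk]

theorem treeTerm_nonneg {x : ℝ} (hx : 0 ≤ x) (k : ℕ) : 0 ≤ treeTerm x k := by
  unfold treeTerm
  split_ifs
  · exact le_rfl
  · positivity

theorem treeTerm_le {x : ℝ} (hx : 0 ≤ x) (hx1 : x ≤ 1) (k : ℕ) : treeTerm x k ≤ x := by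
  unfold treeTerm
  split_ifs
  · exact hx
  · exact pow_le_of_le_one hx hx1 (Nat.succ_ne_zero _)

theorem logTail_nonneg {w : ℝ} (hw : w < 1) : 0 ≤ logTail w := by
  have := Real.log_le_sub_one_of_pos (sub_pos.2 hw)
  unfold logTail
  linarith

theorem add_logTail_le {w : ℝ} (hw : w < 1) : w + logTail w ≤ w / (1 - w) := by
  have h := Real.one_sub_inv_le_log_of_pos (sub_pos.2 hw)
  have h1 : (1 - w) ≠ 0 := (sub_pos.2 hw).ne'
  have h2 : w / (1 - w) = -(1 - (1 - w)⁻¹) := by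
    field_simp
    ring
  rw [h2]
  unfold logTail
  linarith

theorem logTail_le {w : ℝ} (hw : w < 1) : logTail w ≤ w ^ 2 / (1 - w) := by
  have h := add_logTail_le hw
  have h1 : (1 - w) ≠ 0 := (sub_pos.2 hw).ne'
  have h2 : w ^ 2 / (1 - w) = w / (1 - w) - w := by
    field_simp
    ring
  linarith

theorem inv_one_sub_eq_exp {w : ℝ} (hw : w < 1) : (1 - w)⁻¹ = Real.exp (w + logTail w) := by
  rw [logTail, add_sub_cancel, Real.exp_neg, Real.exp_log (sub_pos.2 hw)]

/-- This is the Euler product of the completely multiplicative `powEdges x`, whose value at the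
`k`-th prime is `treeTerm x k`. Index zero is excluded because `nthPrime 0` and `nthPrime 1`
coincide. -/
theorem hasSum_factoredNumbers {x : ℝ} (hx : 0 ≤ x) (hx1 : x < 1) {s : Finset ℕ}
    (hs : ∀ k ∈ s, k ≠ 0) :
    HasSum (fun m : Nat.factoredNumbers (s.image nthPrime) => treeTerm x m)
      (x * Real.exp (∑ k ∈ s, treeTerm x k + ∑ k ∈ s, logTail (treeTerm x k))) := by
  have h1 : ∀ {p : ℕ}, p.Prime → ‖powEdges x p‖ < 1 := by
    intro p hp
    rw [← nthPrime_primeIndex hp, powEdges_nthPrime (primeIndex_pos _),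
      Real.norm_of_nonneg (treeTerm_nonneg hx _)]
    exact (treeTerm_le hx hx1.le _).trans_lt hx1
  have h2 := (EulerProduct.summable_and_hasSum_factoredNumbers_prod_filter_prime_geometric h1
    (s.image nthPrime)).2
  have h3 : {p ∈ s.image nthPrime | p.Prime} = s.image nthPrime :=
    Finset.filter_true_of_mem fun p hp => by
      obtain ⟨k, -, rfl⟩ := Finset.mem_image.1 hp
      exact prime_nthPrime k
  rw [h3, Finset.prod_image fun k hk l hl h => nthPrime_injOn (hs k hk) (hs l hl) h] at h2
  have h4 : ∏ k ∈ s, (1 - powEdges x (nthPrime k))⁻¹ =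
      Real.exp (∑ k ∈ s, treeTerm x k + ∑ k ∈ s, logTail (treeTerm x k)) := by
    rw [← Finset.sum_add_distrib, Real.exp_sum]
    refine Finset.prod_congr rfl fun k hk => ?_
    rw [powEdges_nthPrime (hs k hk),
      inv_one_sub_eq_exp ((treeTerm_le hx hx1.le _).trans_lt hx1)]
  rw [h4] at h2
  simpa only [treeTerm_eq] using h2.mul_left x

/-- The trees all of whose branches at the root belong to `s` contribute at most an Euler
product over `s`. -/
theorem sum_treeTerm_le {x : ℝ} (hx : 0 ≤ x) (hx1 : x < 1) {s t : Finset ℕ}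
    (hs : ∀ k ∈ s, k ≠ 0)
    (ht : ∀ m ∈ t, m ≠ 0 ∧ ∀ p : ℕ, p.Prime → p ∣ m → primeIndex p ∈ s) :
    ∑ m ∈ t, treeTerm x m ≤
      x * Real.exp (∑ k ∈ s, treeTerm x k + ∑ k ∈ s, logTail (treeTerm x k)) := by
  have hmem : ∀ m ∈ t, m ∈ Nat.factoredNumbers (s.image nthPrime) := by
    intro m hm
    refine ⟨(ht m hm).1, fun p hp => ?_⟩
    have hp' := Nat.prime_of_mem_primeFactorsList hp
    exact Finset.mem_image.2 ⟨_, (ht m hm).2 p hp' (Nat.dvd_of_mem_primeFactorsList hp),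
      nthPrime_primeIndex hp'⟩
  have h := sum_le_hasSum (t.attach.map ⟨fun m => (⟨m.1, hmem m.1 m.2⟩ :
    Nat.factoredNumbers (s.image nthPrime)), fun a b hab => Subtype.ext (by simpa using hab)⟩)
    (fun m _ => treeTerm_nonneg hx _) (hasSum_factoredNumbers hx hx1 hs)
  rw [Finset.sum_map] at h
  rw [← Finset.sum_attach]
  exact h

theorem mul_exp_le_tsum {x : ℝ} (hx : 0 ≤ x) (hx1 : x < 1) (h : Summable (treeTerm x))
    {s : Finset ℕ} (hs : ∀ k ∈ s, k ≠ 0) :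
    x * Real.exp (∑ k ∈ s, treeTerm x k + ∑ k ∈ s, logTail (treeTerm x k)) ≤
      ∑' k, treeTerm x k := by
  rw [← (hasSum_factoredNumbers hx hx1 hs).tsum_eq]
  exact h.tsum_subtype_le _ _ (treeTerm_nonneg hx)

theorem treeTerm_lt_one {x : ℝ} (hx : 0 ≤ x) (hx1 : x < 1) (k : ℕ) : treeTerm x k < 1 :=
  (treeTerm_le hx hx1.le k).trans_lt hx1

theorem treeTerm_sq {x y : ℝ} (hxy : x ^ 2 = y) (k : ℕ) : treeTerm x k ^ 2 = treeTerm y k := by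
  unfold treeTerm
  split_ifs
  · simp
  · rw [← hxy, ← pow_mul, ← pow_mul, mul_comm]

/-- `logTail` begins with a quadratic term, and squaring a tree term squares its argument.
Convergence at `ρ` thus controls these sums up to `√ρ`, which lies beyond `ρ`. -/
theorem logTail_treeTerm_le {x y z : ℝ} (hx : 0 ≤ x) (hxy : x ≤ y) (hy : y < 1)
    (hz : y ^ 2 = z) (k : ℕ) : logTail (treeTerm x k) ≤ treeTerm z k / (1 - y) := by
  have h1 : treeTerm x k ≤ treeTerm y k := by
    unfold treeTerm
    split_ifs
    · exact le_rfl
    · gcongr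
  have h2 := treeTerm_le (hx.trans hxy) hy.le k
  have h0 := treeTerm_nonneg hx k
  refine (logTail_le (treeTerm_lt_one hx (hxy.trans_lt hy) k)).trans ?_
  rw [← treeTerm_sq hz]
  have : 0 < 1 - y := sub_pos.2 hy
  gcongr
  exact h1.trans h2

theorem summable_logTail_of_sq {x y z : ℝ} (hx : 0 ≤ x) (hxy : x ≤ y) (hy : y < 1)
    (hz : y ^ 2 = z) (h : Summable (treeTerm z)) : Summable fun k => logTail (treeTerm x k) :=
  Summable.of_nonneg_of_le (fun k => logTail_nonneg (treeTerm_lt_one hx (hxy.trans_lt hy) k))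
    (logTail_treeTerm_le hx hxy hy hz) (h.div_const _)

theorem summable_logTail {x : ℝ} (hx : 0 ≤ x) (hx1 : x < 1) (h : Summable (treeTerm x)) :
    Summable fun k => logTail (treeTerm x k) := by
  refine summable_logTail_of_sq hx le_rfl hx1 rfl
    (Summable.of_nonneg_of_le (fun k => treeTerm_nonneg (sq_nonneg x) k) (fun k => ?_) h)
  rw [← treeTerm_sq rfl, sq]
  exact mul_le_of_le_one_left (treeTerm_nonneg hx k) (treeTerm_lt_one hx hx1 k).le

/-- The factor of the functional equation of the generating function of rooted trees that is
regular at the radius of convergence. -/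
noncomputable def regularFactor (x : ℝ) : ℝ := x * Real.exp (∑' k, logTail (treeTerm x k))

theorem sum_treeTerm_le_regularFactor {x : ℝ} (hx : 0 ≤ x) (hx1 : x < 1)
    (h : Summable fun k => logTail (treeTerm x k)) {s t : Finset ℕ}
    (hs : ∀ k ∈ s, k ≠ 0)
    (ht : ∀ m ∈ t, m ≠ 0 ∧ ∀ p : ℕ, p.Prime → p ∣ m → primeIndex p ∈ s) :
    ∑ m ∈ t, treeTerm x m ≤ regularFactor x * Real.exp (∑ k ∈ s, treeTerm x k) := by
  refine (sum_treeTerm_le hx hx1 hs ht).trans ?_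
  rw [regularFactor, mul_assoc, ← Real.exp_add, add_comm]
  gcongr
  exact h.sum_le_tsum _ fun k _ => logTail_nonneg (treeTerm_lt_one hx hx1 k)

/-- With `R` the sum of the series, the Euler product gives `F * exp R ≤ R`, and `R ≤ exp (R - 1)`
always holds. -/
theorem regularFactor_le {x : ℝ} (hx : 0 ≤ x) (hx1 : x < 1) (h : Summable (treeTerm x)) :
    regularFactor x ≤ Real.exp (-1) := by
  have hlim : Filter.Tendsto (fun n : ℕ =>
      x * Real.exp (∑ k ∈ range n, treeTerm x (k + 1) +
        ∑ k ∈ range n, logTail (treeTerm x (k + 1))))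
      Filter.atTop (nhds (x * Real.exp (∑' k, treeTerm x (k + 1) +
        ∑' k, logTail (treeTerm x (k + 1))))) :=
    ((Real.continuous_exp.tendsto _).comp
      (((summable_nat_add_iff 1).2 h).hasSum.tendsto_sum_nat.add
      ((summable_nat_add_iff (f := fun k => logTail (treeTerm x k)) 1).2
        (summable_logTail hx hx1 h)).hasSum.tendsto_sum_nat)).const_mul x
  have hle := le_of_tendsto' hlim (b := ∑' k, treeTerm x k) fun n => by
    have := mul_exp_le_tsum hx hx1 h (s := (range n).map ⟨Nat.succ, Nat.succ_injective⟩)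
      (fun k hk => by
        obtain ⟨j, -, rfl⟩ := Finset.mem_map.1 hk
        exact Nat.succ_ne_zero j)
    rw [Finset.sum_map, Finset.sum_map] at this
    exact this
  have h1 := h.tsum_eq_zero_add
  have h2 := (summable_logTail hx hx1 h).tsum_eq_zero_add
  have h0 : treeTerm x 0 = 0 := if_pos rfl
  have h0' : logTail 0 = 0 := by simp [logTail]
  rw [h0, zero_add] at h1
  rw [h0, h0', zero_add] at h2
  rw [← h1, ← h2, Real.exp_add, mul_left_comm] at hle
  set R := ∑' k, treeTerm x k
  have h3 : R ≤ Real.exp (R - 1) := by simpa using Real.add_one_le_exp (R - 1)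
  rw [sub_eq_add_neg, Real.exp_add] at h3
  exact le_of_mul_le_mul_left (hle.trans h3) (Real.exp_pos R)

theorem primeIndex_lt_of_dvd {m p M : ℕ} (hm : m ≠ 0) (hmM : m ≤ M) (hp : p.Prime)
    (hpm : p ∣ m) : primeIndex p < M :=
  (primeIndex_lt hp).trans_le ((Nat.le_of_dvd (Nat.pos_of_ne_zero hm) hpm).trans hmM)

theorem sum_range_treeTerm (x : ℝ) (M : ℕ) :
    ∑ k ∈ range M, treeTerm x k = ∑ k ∈ range M with k ≠ 0, treeTerm x k := by
  rw [Finset.sum_filter]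
  refine Finset.sum_congr rfl fun k _ => ?_
  by_cases hk : k = 0 <;> simp [hk, treeTerm]

/-- Every branch of a tree with Matula number at most `M` has Matula number below `M`. A bound `1`
on the shorter partial sum therefore gives `F * exp 1 ≤ 1` for the next. -/
theorem sum_range_le_one_of_regularFactor_le {x : ℝ} (hx : 0 ≤ x) (hx1 : x < 1)
    (h : Summable fun k => logTail (treeTerm x k)) (hF : regularFactor x ≤ Real.exp (-1)) (M : ℕ) :
    ∑ k ∈ range M, treeTerm x k ≤ 1 := by
  induction M with
  | zero => simp
  | succ M ih =>
    rw [sum_range_treeTerm] at ih ⊢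
    calc ∑ k ∈ range (M + 1) with k ≠ 0, treeTerm x k
        ≤ regularFactor x * Real.exp (∑ k ∈ range M with k ≠ 0, treeTerm x k) := by
          refine sum_treeTerm_le_regularFactor hx hx1 h (fun k hk => (Finset.mem_filter.1 hk).2)
            fun m hm => ?_
          obtain ⟨h1, h2⟩ := Finset.mem_filter.1 hm
          refine ⟨h2, fun p hp hpm => Finset.mem_filter.2 ⟨Finset.mem_range.2 ?_,
            primeIndex_pos p⟩⟩
          exact primeIndex_lt_of_dvd h2 (Nat.lt_succ_iff.1 (Finset.mem_range.1 h1)) hp hpm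
      _ ≤ Real.exp (-1) * Real.exp 1 := by gcongr
      _ = 1 := by rw [← Real.exp_add]; simp

/-- The same induction with cruder constants: for `w ≤ 1/8` one has `w + logTail w ≤ 2 * w`, and
`exp 2 ≤ 8`. -/
theorem sum_range_treeTerm_eighth_le (M : ℕ) : ∑ k ∈ range M, treeTerm (1 / 8) k ≤ 1 := by
  induction M with
  | zero => simp
  | succ M ih =>
    rw [sum_range_treeTerm] at ih ⊢
    have h0 : (0 : ℝ) ≤ 1 / 8 := by norm_num
    have h1 : (1 / 8 : ℝ) < 1 := by norm_num
    refine (sum_treeTerm_le h0 h1 (s := {k ∈ range M | k ≠ 0})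
      (fun k hk => (Finset.mem_filter.1 hk).2) fun m hm => ?_).trans ?_
    · obtain ⟨h1, h2⟩ := Finset.mem_filter.1 hm
      refine ⟨h2, fun p hp hpm => Finset.mem_filter.2 ⟨Finset.mem_range.2 ?_,
        primeIndex_pos p⟩⟩
      exact primeIndex_lt_of_dvd h2 (Nat.lt_succ_iff.1 (Finset.mem_range.1 h1)) hp hpm
    · have h2 : ∑ k ∈ range M with k ≠ 0, treeTerm (1 / 8) k +
          ∑ k ∈ range M with k ≠ 0, logTail (treeTerm (1 / 8) k) ≤ 2 := by
        rw [← Finset.sum_add_distrib]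
        calc _ ≤ ∑ k ∈ range M with k ≠ 0, 2 * treeTerm (1 / 8) k := by
              refine Finset.sum_le_sum fun k _ => ?_
              have h3 := treeTerm_le h0 h1.le k
              have h4 := treeTerm_nonneg h0 k
              refine (add_logTail_le (treeTerm_lt_one h0 h1 k)).trans ?_
              rw [div_le_iff₀ (by linarith)]
              nlinarith
          _ ≤ 2 := by
              rw [← Finset.mul_sum]
              linarith
      have h3 : Real.exp 2 ≤ 8 := by
        have h4 : Real.exp 2 = Real.exp 1 ^ 2 := by rw [← Real.exp_nat_mul]; norm_num
        rw [h4]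
        nlinarith [Real.exp_one_lt_d9, Real.exp_pos 1]
      calc _ ≤ 1 / 8 * Real.exp 2 := by gcongr
        _ ≤ 1 := by linarith

theorem summable_treeTerm_of_le_one {x : ℝ} (hx : 0 ≤ x)
    (h : ∀ M, ∑ k ∈ range M, treeTerm x k ≤ 1) : Summable (treeTerm x) :=
  summable_of_sum_range_le (treeTerm_nonneg hx) h

theorem edges_two : edges 2 = 1 := by
  rw [edges_prime Nat.prime_two]
  have : primeIndex 2 = 1 := by
    rw [primeIndex]
    have := primeIndex_lt Nat.prime_two
    rw [primeIndex] at this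
    omega
  rw [this, edges_one]

/-- The radius of convergence of the generating function of rooted trees. -/
theorem exists_radius : ∃ ρ : ℝ, 0 < ρ ∧ ρ < 1 ∧ (∀ M, ∑ k ∈ range M, treeTerm ρ k ≤ 1) ∧
    ∀ y, ρ < y → y < 1 → ¬ Summable (treeTerm y) := by
  set K : Set ℝ := {x | x ∈ Set.Icc (0 : ℝ) 1 ∧ ∀ M, ∑ k ∈ range M, treeTerm x k ≤ 1} with hK
  have hcont : ∀ M, Continuous fun x : ℝ => ∑ k ∈ range M, treeTerm x k := by
    intro M
    refine continuous_finsetSum _ fun k _ => ?_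
    by_cases hk : k = 0
    · simpa [treeTerm, hk] using continuous_const
    · simpa [treeTerm, hk] using continuous_pow _
  have hKc : IsCompact K := by
    have h1 : K = Set.Icc (0 : ℝ) 1 ∩ ⋂ M, {x | ∑ k ∈ range M, treeTerm x k ≤ 1} := by
      ext x
      simp [hK]
    rw [h1]
    exact isCompact_Icc.inter_right (isClosed_iInter fun M => isClosed_le (hcont M)
      continuous_const)
  have h8 : (1 / 8 : ℝ) ∈ K := ⟨⟨by norm_num, by norm_num⟩, sum_range_treeTerm_eighth_le⟩
  obtain ⟨ρ, hρ, hmax⟩ := hKc.exists_isGreatest ⟨_, h8⟩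
  have h0 : 0 < ρ := lt_of_lt_of_le (by norm_num) (hmax h8)
  have h1 : ρ < 1 := by
    -- The trees with one and two vertices already give `ρ + ρ ^ 2 ≤ 1`.
    have := hρ.2 3
    simp only [Finset.sum_range_succ, Finset.sum_range_zero, treeTerm, edges_one, edges_two] at this
    norm_num at this
    nlinarith
  refine ⟨ρ, h0, h1, hρ.2, fun y hy hy1 hsum => ?_⟩
  have hy0 := (h0.trans hy).le
  exact hy.not_ge (hmax ⟨⟨hy0, hy1.le⟩, sum_range_le_one_of_regularFactor_le hy0 hy1
    (summable_logTail hy0 hy1 hsum) (regularFactor_le hy0 hy1 hsum)⟩)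

theorem continuousAt_regularFactor {ρ : ℝ} (h0 : 0 < ρ) (h1 : ρ < 1)
    (h : Summable (treeTerm ρ)) : ContinuousAt regularFactor ρ := by
  have hs : (√ρ) ^ 2 = ρ := Real.sq_sqrt h0.le
  have hs1 : √ρ < 1 := by rw [Real.sqrt_lt' one_pos]; simpa
  have hlt : ρ < √ρ := by rw [Real.lt_sqrt h0.le]; nlinarith
  have hH : ContinuousOn (fun x => ∑' k, logTail (treeTerm x k)) (Set.Icc 0 (√ρ)) := by
    refine continuousOn_tsum (u := fun k => treeTerm ρ k / (1 - √ρ)) (fun k => ?_)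
      (h.div_const _) fun k x hx => ?_
    · intro x hx
      have hx1 := treeTerm_lt_one hx.1 (hx.2.trans_lt hs1) k
      refine ContinuousAt.continuousWithinAt ?_
      unfold logTail
      have hc : ContinuousAt (fun x => treeTerm x k) x := by
        by_cases hk : k = 0
        · simpa [treeTerm, hk] using continuousAt_const
        · simpa [treeTerm, hk] using (continuous_pow _).continuousAt
      exact (((continuousAt_const.sub hc).log (sub_pos.2 hx1).ne').neg).sub hc
    · rw [Real.norm_of_nonneg (logTail_nonneg (treeTerm_lt_one hx.1 (hx.2.trans_lt hs1) k))]
      exact logTail_treeTerm_le hx.1 hx.2 hs1 hs k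
  have := hH.continuousAt (Icc_mem_nhds h0 hlt)
  exact continuousAt_id.mul (Real.continuous_exp.continuousAt.comp this)

open Classical in
/-- If the trees with property `Q` include every tree with a branch in `Q`, then the generating
function of the other trees has a larger radius of convergence. -/
theorem exists_sum_le_one {ρ : ℝ} (h0 : 0 < ρ) (h1 : ρ < 1)
    (hρ : ∀ M, ∑ k ∈ range M, treeTerm ρ k ≤ 1) (Q : ℕ → Prop)
    (hQ : ∀ m p : ℕ, m ≠ 0 → p.Prime → p ∣ m → Q (primeIndex p) → Q m)
    (hex : ∃ m, m ≠ 0 ∧ Q m) :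
    ∃ x, ρ < x ∧ x < 1 ∧ ∀ t : Finset ℕ, (∀ m ∈ t, m ≠ 0 ∧ ¬ Q m) →
      ∑ m ∈ t, treeTerm x m ≤ 1 := by
  obtain ⟨hL0, hLQ⟩ := Nat.find_spec hex
  have hmin := fun m => Nat.find_min hex (m := m)
  set L := Nat.find hex
  have hsum := summable_treeTerm_of_le_one h0.le hρ
  have hs : (√ρ) ^ 2 = ρ := Real.sq_sqrt h0.le
  have hs1 : √ρ < 1 := by rw [Real.sqrt_lt' one_pos]; simpa
  have hlt : ρ < √ρ := by rw [Real.lt_sqrt h0.le]; nlinarith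
  have hLpos : 0 < treeTerm ρ L := by
    rw [treeTerm_of_ne_zero hL0]
    positivity
  have e1 : ∀ᶠ x in nhds ρ, regularFactor x < (1 + treeTerm ρ L) * Real.exp (-1) :=
    (continuousAt_regularFactor h0 h1 hsum).eventually_lt_const (by
      refine (regularFactor_le h0.le h1 hsum).trans_lt ?_
      have := Real.exp_pos (-1)
      nlinarith)
  -- At `ρ` the partial sum including the positive term of `L` is at most `1`, so without that term
  -- it is strictly smaller. This feeds the base of the induction.
  have e2 : ∀ᶠ x in nhds ρ, ∑ k ∈ range L, treeTerm x k < 1 := by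
    have hc : Continuous fun x : ℝ => ∑ k ∈ range L, treeTerm x k := by
      refine continuous_finsetSum _ fun k _ => ?_
      by_cases hk : k = 0
      · simpa [treeTerm, hk] using continuous_const
      · simpa [treeTerm, hk] using continuous_pow _
    refine hc.continuousAt.eventually_lt_const ?_
    have := hρ (L + 1)
    rw [Finset.sum_range_succ] at this
    linarith
  obtain ⟨x, ⟨⟨hx1, hx2⟩, hxρ, hxs⟩⟩ := (((e1.and e2).filter_mono nhdsWithin_le_nhds).and
    (Ioo_mem_nhdsGT hlt)).exists
  have hx0 : 0 ≤ x := (h0.trans hxρ).le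
  have hxlt : x < 1 := hxs.trans hs1
  have hH := summable_logTail_of_sq hx0 hxs.le hs1 hs hsum
  have hLx : treeTerm ρ L ≤ treeTerm x L := by
    rw [treeTerm_of_ne_zero hL0, treeTerm_of_ne_zero hL0]
    gcongr
  -- By minimality all branches of `L` avoid `Q`, so `L` may be added on the left of the Euler
  -- product bound although it has property `Q`. Its term absorbs the excess of `F x` over `exp
  -- (-1)`.
  have key : ∀ M, L ≤ M → ∑ k ∈ range M with k ≠ 0 ∧ ¬ Q k, treeTerm x k ≤ 1 := by
    intro M hM
    induction M, hM using Nat.le_induction with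
    | base =>
      exact (Finset.sum_le_sum_of_subset_of_nonneg (Finset.filter_subset _ _)
        fun k _ _ => treeTerm_nonneg hx0 k).trans hx2.le
    | succ M hM ih =>
      have hnot : L ∉ {k ∈ range (M + 1) | k ≠ 0 ∧ ¬ Q k} := fun h =>
        (Finset.mem_filter.1 h).2.2 hLQ
      have h := sum_treeTerm_le_regularFactor hx0 hxlt hH
        (s := {k ∈ range M | k ≠ 0 ∧ ¬ Q k}) (t := insert L {k ∈ range (M + 1) | k ≠ 0 ∧ ¬ Q k})
        (fun k hk => (Finset.mem_filter.1 hk).2.1) (fun m hm => by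
          rcases Finset.mem_insert.1 hm with rfl | hm
          · refine ⟨hL0, fun p hp hpm => ?_⟩
            have hlt := primeIndex_lt_of_dvd hL0 le_rfl hp hpm
            exact Finset.mem_filter.2 ⟨Finset.mem_range.2 (hlt.trans_le hM), primeIndex_pos p,
              fun hq => hmin _ hlt ⟨primeIndex_pos p, hq⟩⟩
          · obtain ⟨hm1, hm2, hm3⟩ := Finset.mem_filter.1 hm
            refine ⟨hm2, fun p hp hpm => Finset.mem_filter.2 ⟨Finset.mem_range.2 ?_,
              primeIndex_pos p, fun hq => hm3 (hQ m p hm2 hp hpm hq)⟩⟩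
            exact primeIndex_lt_of_dvd hm2 (Nat.lt_succ_iff.1 (Finset.mem_range.1 hm1)) hp hpm)
      rw [Finset.sum_insert hnot] at h
      have h2 : regularFactor x * Real.exp (∑ k ∈ range M with k ≠ 0 ∧ ¬ Q k, treeTerm x k) ≤
          1 + treeTerm ρ L := by
        calc _ ≤ (1 + treeTerm ρ L) * Real.exp (-1) * Real.exp 1 := by gcongr
          _ = 1 + treeTerm ρ L := by rw [mul_assoc, ← Real.exp_add]; simp
      linarith
  refine ⟨x, hxρ, hxlt, fun t ht => ?_⟩
  refine (Finset.sum_le_sum_of_subset_of_nonneg (t := {k ∈ range (max L (t.sup id + 1)) |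
    k ≠ 0 ∧ ¬ Q k}) (fun m hm => ?_) fun k _ _ => treeTerm_nonneg hx0 k).trans
    (key _ (le_max_left _ _))
  refine Finset.mem_filter.2 ⟨Finset.mem_range.2 (lt_max_of_lt_right (Nat.lt_succ_of_le ?_)),
    ht m hm⟩
  exact Finset.le_sup (f := id) hm

/-! ### Growth of the number of rooted trees. -/

/-- The Matula numbers of the rooted trees with `n` edges and property `P`. -/
def matulaSet (P : ℕ → Prop) (n : ℕ) : Set ℕ := {m | m ≠ 0 ∧ edges m = n ∧ P m}

theorem card_mul_pow_le {x : ℝ} {n : ℕ} {t : Finset ℕ} {P : ℕ → Prop}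
    (ht : ∀ m ∈ t, m ∈ matulaSet P n) (h : ∑ m ∈ t, treeTerm x m ≤ 1) :
    (t.card : ℝ) * x ^ (n + 1) ≤ 1 := by
  have : ∑ m ∈ t, treeTerm x m = ∑ m ∈ t, x ^ (n + 1) :=
    Finset.sum_congr rfl fun m hm => by rw [treeTerm_of_ne_zero (ht m hm).1, (ht m hm).2.1]
  rwa [this, Finset.sum_const, nsmul_eq_mul] at h

/-- Each tree with `n` edges contributes `ρ ^ (n + 1)` to partial sums that never exceed `1`. -/
theorem finite_matulaSet (P : ℕ → Prop) (n : ℕ) : (matulaSet P n).Finite := by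
  obtain ⟨ρ, h0, -, hρ, -⟩ := exists_radius
  by_contra hinf
  obtain ⟨N, hN⟩ := exists_nat_gt (1 / ρ ^ (n + 1))
  obtain ⟨t, ht, hcard⟩ := Set.Infinite.exists_subset_card_eq hinf N
  have h := card_mul_pow_le (x := ρ) (fun m hm => ht hm)
    ((Finset.sum_le_sum_of_subset_of_nonneg (t := range (t.sup id + 1)) (fun m hm =>
      Finset.mem_range.2 (Nat.lt_succ_of_le (Finset.le_sup (f := id) hm)))
      fun k _ _ => treeTerm_nonneg h0.le k).trans (hρ _))
  rw [hcard, ← le_div_iff₀ (by positivity)] at h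
  linarith

/-- The number of rooted trees with `n` edges and property `P`. -/
noncomputable def rootedCount (P : ℕ → Prop) (n : ℕ) : ℕ := (matulaSet P n).ncard

theorem rootedCount_mul_pow_le {x : ℝ} {P : ℕ → Prop}
    (h : ∀ t : Finset ℕ, (∀ m ∈ t, m ≠ 0 ∧ P m) → ∑ m ∈ t, treeTerm x m ≤ 1) (n : ℕ) :
    (rootedCount P n : ℝ) * x ^ (n + 1) ≤ 1 := by
  rw [rootedCount, Set.ncard_eq_toFinset_card _ (finite_matulaSet P n)]
  have ht : ∀ m ∈ (finite_matulaSet P n).toFinset, m ∈ matulaSet P n := fun m hm => by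
    simpa using hm
  exact card_mul_pow_le ht (h _ fun m hm => ⟨(ht m hm).1, (ht m hm).2.2⟩)

theorem rootedCount_pos (n : ℕ) : 0 < rootedCount (fun _ => True) n := by
  -- The number `2 ^ n` belongs to the star with `n` edges rooted at its centre.
  refine (Set.ncard_pos (finite_matulaSet _ n)).2 ⟨2 ^ n, by positivity, ?_, trivial⟩
  induction n with
  | zero => rw [pow_zero, edges_one]
  | succ n ih => rw [pow_succ, edges_mul (by positivity) two_ne_zero, ih, edges_two]

/-- Two trees are hung from a new root after marking them. The first receives two extra leaves at
its root (factor `4`), the second a new root above it. Their numbers are then composite and prime,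
so the pair can be recovered. The marking and the two new edges cost five edges. -/
theorem rootedCount_mul_le (a b : ℕ) :
    rootedCount (fun _ => True) a * rootedCount (fun _ => True) b ≤
      rootedCount (fun _ => True) (a + b + 5) := by
  rw [rootedCount, rootedCount, rootedCount, ← Set.ncard_prod]
  refine Set.ncard_le_ncard_of_injOn
    (fun q : ℕ × ℕ => nthPrime (4 * q.1) * nthPrime (nthPrime q.2)) ?_ ?_ (finite_matulaSet _ _)
  · rintro ⟨m, m'⟩ ⟨⟨(h1 : m ≠ 0), (h2 : edges m = a), -⟩, (h3 : m' ≠ 0), (h4 : edges m' = b), -⟩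
    have h4m : 4 * m ≠ 0 := mul_ne_zero four_ne_zero h1
    have h4' : edges 4 = 2 := by
      rw [show 4 = 2 * 2 from rfl, edges_mul two_ne_zero two_ne_zero, edges_two]
    refine ⟨mul_ne_zero (prime_nthPrime _).ne_zero (prime_nthPrime _).ne_zero, ?_, trivial⟩
    change edges (nthPrime (4 * m) * nthPrime (nthPrime m')) = _
    rw [edges_mul (prime_nthPrime _).ne_zero (prime_nthPrime _).ne_zero, edges_nthPrime h4m,
      edges_nthPrime (prime_nthPrime _).ne_zero, edges_nthPrime h3, edges_mul four_ne_zero h1, h4']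
    omega
  · rintro ⟨m, m'⟩ ⟨⟨h1, -⟩, h2, -⟩ ⟨l, l'⟩ ⟨⟨h3, -⟩, h4, -⟩ h
    change nthPrime (4 * m) * nthPrime (nthPrime m') =
      nthPrime (4 * l) * nthPrime (nthPrime l') at h
    have hml : nthPrime (4 * m) = nthPrime (4 * l) := by
      rcases (prime_nthPrime (4 * m)).dvd_mul.1 (h ▸ Dvd.intro _ rfl) with hd | hd
      · exact (Nat.prime_dvd_prime_iff_eq (prime_nthPrime _) (prime_nthPrime _)).1 hd
      · have := nthPrime_injOn (mul_ne_zero four_ne_zero h1) (prime_nthPrime _).ne_zero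
          ((Nat.prime_dvd_prime_iff_eq (prime_nthPrime _) (prime_nthPrime _)).1 hd)
        have hp := prime_nthPrime l'
        rw [← this, show 4 * m = 2 * (2 * m) by ring] at hp
        exact absurd hp (Nat.not_prime_mul (by norm_num) (by omega))
    rw [hml] at h
    have h5 := nthPrime_injOn (mul_ne_zero four_ne_zero h1) (mul_ne_zero four_ne_zero h3) hml
    have h6 := nthPrime_injOn h2 h4 (nthPrime_injOn (prime_nthPrime _).ne_zero
      (prime_nthPrime _).ne_zero (Nat.eq_of_mul_eq_mul_left (prime_nthPrime _).pos h))
    exact Prod.ext (by change m = l; omega) h6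

/-- Otherwise the counts are below `y ^ (-(n + 5))`, and the series at the smaller `y₀` is dominated
by a geometric one. -/
theorem exists_one_le_rootedCount_mul_pow {y₀ y : ℝ} (h0 : 0 < y₀) (hy : y₀ < y)
    (h : ¬ Summable (treeTerm y₀)) :
    ∃ c, 1 ≤ (rootedCount (fun _ => True) c : ℝ) * y ^ (c + 5) := by
  by_contra! hlt
  have hy0 : 0 < y := h0.trans hy
  have hr : y₀ / y < 1 := (div_lt_one hy0).2 hy
  have hg : Summable fun n : ℕ => y₀ / y ^ 5 * (y₀ / y) ^ n :=
    (summable_geometric_of_lt_one (by positivity) hr).mul_left _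
  refine h (summable_of_sum_range_le (c := ∑' n : ℕ, y₀ / y ^ 5 * (y₀ / y) ^ n)
    (treeTerm_nonneg h0.le) fun M => ?_)
  rw [sum_range_treeTerm]
  have hmaps : ∀ k ∈ {k ∈ range M | k ≠ 0}, edges k ∈ {k ∈ range M | k ≠ 0}.image edges :=
    fun k hk => Finset.mem_image_of_mem _ hk
  rw [← Finset.sum_fiberwise_of_maps_to hmaps]
  refine (Finset.sum_le_sum fun n _ => ?_).trans (hg.sum_le_tsum _ fun n _ => by positivity)
  have h1 : ∑ k ∈ {k ∈ range M | k ≠ 0} with edges k = n, treeTerm y₀ k =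
      (#{k ∈ {k ∈ range M | k ≠ 0} | edges k = n} : ℝ) * y₀ ^ (n + 1) := by
    rw [← nsmul_eq_mul, ← Finset.sum_const]
    refine Finset.sum_congr rfl fun k hk => ?_
    rw [Finset.mem_filter, Finset.mem_filter] at hk
    rw [treeTerm_of_ne_zero hk.1.2, hk.2]
  have h2 : (#{k ∈ {k ∈ range M | k ≠ 0} | edges k = n} : ℝ) ≤
      rootedCount (fun _ => True) n := by
    have hsub : (({k ∈ {k ∈ range M | k ≠ 0} | edges k = n} : Finset ℕ) : Set ℕ) ⊆
        matulaSet (fun _ => True) n := fun k hk => by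
      rw [Finset.mem_coe, Finset.mem_filter, Finset.mem_filter] at hk
      exact ⟨hk.1.2, hk.2, trivial⟩
    have hcard := Set.ncard_le_ncard hsub (finite_matulaSet _ _)
    rw [Set.ncard_coe_finset] at hcard
    exact Nat.cast_le.2 hcard
  rw [h1]
  have h3 : (rootedCount (fun _ => True) n : ℝ) ≤ 1 / y ^ (n + 5) := by
    rw [le_div_iff₀ (by positivity)]
    exact (hlt n).le
  calc _ ≤ 1 / y ^ (n + 5) * y₀ ^ (n + 1) := by
        gcongr
        exact h2.trans h3
    _ = y₀ / y ^ 5 * (y₀ / y) ^ n := by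
        rw [div_pow]
        field_simp
        ring

/-- Combining with the fixed size `c` in `rootedCount_mul_le` does not decrease the weighted count,
so the bound propagates in steps of `c + 5`. Below `c + 5`, the existence of one tree suffices. -/
theorem exists_le_rootedCount_mul_pow {y : ℝ} (hy : 0 < y) (hy1 : y < 1)
    (h : ∃ c, 1 ≤ (rootedCount (fun _ => True) c : ℝ) * y ^ (c + 5)) :
    ∃ κ : ℝ, 0 < κ ∧ ∀ n, κ ≤ (rootedCount (fun _ => True) n : ℝ) * y ^ n := by
  obtain ⟨c, hc⟩ := h
  refine ⟨y ^ (c + 5), by positivity, fun n => ?_⟩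
  induction n using Nat.strong_induction_on with
  | _ n ih =>
    have hpos : (1 : ℝ) ≤ rootedCount (fun _ => True) n := by exact_mod_cast rootedCount_pos n
    rcases lt_or_ge n (c + 5) with hn | hn
    · calc y ^ (c + 5) ≤ 1 * y ^ n := by
            rw [one_mul]
            exact pow_le_pow_of_le_one hy.le hy1.le hn.le
        _ ≤ _ := by gcongr
    · obtain ⟨j, rfl⟩ := Nat.exists_eq_add_of_le' hn
      have h1 : (rootedCount (fun _ => True) j : ℝ) * rootedCount (fun _ => True) c ≤
          rootedCount (fun _ => True) (j + (c + 5)) := by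
        exact_mod_cast rootedCount_mul_le j c
      have h2 := ih j (by omega)
      calc y ^ (c + 5) ≤ (rootedCount (fun _ => True) j : ℝ) * y ^ j := h2
        _ ≤ (rootedCount (fun _ => True) j : ℝ) * y ^ j *
            (rootedCount (fun _ => True) c * y ^ (c + 5)) :=
          le_mul_of_one_le_right (by positivity) hc
        _ = rootedCount (fun _ => True) j * rootedCount (fun _ => True) c *
            y ^ (j + (c + 5)) := by ring
        _ ≤ _ := by gcongr

/-- Almost all rooted trees contain a branch with property `Q`, even when weighted by the number
of vertices. -/
theorem tendsto_rootedCount_div (Q : ℕ → Prop)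
    (hQ : ∀ m p : ℕ, m ≠ 0 → p.Prime → p ∣ m → Q (primeIndex p) → Q m)
    (hex : ∃ m, m ≠ 0 ∧ Q m) :
    Filter.Tendsto (fun n : ℕ => ((n + 1 : ℕ) : ℝ) * rootedCount (fun m => ¬ Q m) n /
      rootedCount (fun _ => True) n) Filter.atTop (nhds 0) := by
  obtain ⟨ρ, h0, h1, hρ, hdiv⟩ := exists_radius
  obtain ⟨x, hρx, hx1, hx⟩ := exists_sum_le_one h0 h1 hρ Q hQ hex
  -- With `ρ < y₀ < y < x`, limb-free counts are `O(x ^ (-n))` and all counts are at least a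
  -- constant times `y ^ (-n)`. The weighted ratio is `O((n + 1) * (y / x) ^ n)`.
  obtain ⟨y, hρy, hyx⟩ := exists_between hρx
  obtain ⟨y₀, hρy₀, hy₀y⟩ := exists_between hρy
  have hy0 : 0 < y := h0.trans hρy
  have hx0 : 0 < x := h0.trans hρx
  obtain ⟨κ, hκ, hlow⟩ := exists_le_rootedCount_mul_pow hy0 (hyx.trans hx1)
    (exists_one_le_rootedCount_mul_pow (h0.trans hρy₀) hy₀y
      (hdiv y₀ hρy₀ (hy₀y.trans (hyx.trans hx1))))
  have hr : y / x < 1 := (div_lt_one hx0).2 hyx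
  have hr0 : 0 ≤ y / x := by positivity
  have hlim : Filter.Tendsto (fun n : ℕ => 1 / (x * κ) * ((n : ℝ) * (y / x) ^ n + (y / x) ^ n))
      Filter.atTop (nhds (1 / (x * κ) * (0 + 0))) :=
    ((tendsto_self_mul_const_pow_of_lt_one hr0 hr).add
      (tendsto_pow_atTop_nhds_zero_of_lt_one hr0 hr)).const_mul _
  rw [add_zero, mul_zero] at hlim
  refine squeeze_zero (fun n => by positivity) (fun n => ?_) hlim
  have hpos : (0 : ℝ) < rootedCount (fun _ => True) n := by exact_mod_cast rootedCount_pos n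
  have ha := rootedCount_mul_pow_le hx n
  have hu := hlow n
  have ha' : (rootedCount (fun m => ¬ Q m) n : ℝ) ≤ 1 / x ^ (n + 1) := by
    rw [le_div_iff₀ (by positivity)]
    exact ha
  rw [div_le_iff₀ hpos]
  calc ((n + 1 : ℕ) : ℝ) * rootedCount (fun m => ¬ Q m) n
      ≤ ((n + 1 : ℕ) : ℝ) * (1 / x ^ (n + 1)) := by gcongr
    _ = 1 / (x * κ) * ((n : ℝ) * (y / x) ^ n + (y / x) ^ n) * (κ / y ^ n) := by
        rw [div_pow]
        push_cast
        field_simp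
        ring
    _ ≤ _ := by
        gcongr
        rw [div_le_iff₀ (by positivity)]
        exact hu

/-! ### From rooted trees to unrooted trees. -/

namespace PlaneTree

/-- The property of Matula numbers that some ordered tree with that number has `k` limb
vertices. -/
def MatulaHasLimbVertices (k m : ℕ) : Prop := ∃ t, matula t = m ∧ HasLimbVertices k t

theorem MatulaHasLimbVertices.of_branch {k m p : ℕ} (hm : m ≠ 0) (hp : p.Prime) (hpm : p ∣ m)
    (h : MatulaHasLimbVertices k (primeIndex p)) : MatulaHasLimbVertices k m := by
  obtain ⟨s, hs, hk⟩ := h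
  obtain ⟨l, rfl⟩ := hpm
  obtain ⟨t, ht⟩ := exists_matula_eq (right_ne_zero_of_mul hm)
  exact ⟨graft t s, by rw [matula, ht, hs, nthPrime_primeIndex hp, mul_comm], hk.graft_right t⟩

end PlaneTree

open PlaneTree

/-- An ordered tree whose graph is the given tree. -/
theorem Tree.exists_planeTree {n : ℕ} (T : Tree n) :
    ∃ t : PlaneTree, Nonempty (T.out.1 ≃g graph t) :=
  exists_graph_iso _ T.out.1 T.out.2 rfl

theorem Tree.hasCospectralNonsimilar_iff {n k : ℕ} (T : Tree n) :
    T.HasCospectralNonsimilar k ↔ TreeCospec.HasCospectralNonsimilar k T.out.1 := by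
  conv_lhs => rw [← Quotient.out_eq T]
  exact Iff.rfl

/-- One rooting is chosen for each tree. Its Matula number determines the tree up to isomorphism and
cannot belong to a tree with limb vertices. -/
theorem card_bad_le (k n : ℕ) :
    Nat.card {T : Tree (n + 1) // ¬ T.HasCospectralNonsimilar k} ≤
      rootedCount (fun m => ¬ MatulaHasLimbVertices k m) n := by
  choose f hf using fun T : Tree (n + 1) => T.exists_planeTree
  have hfin := finite_matulaSet (fun m => ¬ MatulaHasLimbVertices k m) n
  have := hfin.to_subtype
  rw [rootedCount, ← Nat.card_coe_set_eq]
  refine Nat.card_le_card_of_injective (fun T => ⟨matula (f T.1), matula_ne_zero _, ?_, ?_⟩) ?_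
  · obtain ⟨e⟩ := hf T.1
    have h1 := Fintype.card_congr e.toEquiv
    rw [Fintype.card_fin, card_vert, ← edges_matula] at h1
    omega
  · rintro ⟨t, ht, hk⟩
    obtain ⟨e⟩ := hf T.1
    obtain ⟨g, -⟩ := rootedIso_of_matula_eq ht
    exact T.2 (T.1.hasCospectralNonsimilar_iff.2
      (hk.hasCospectralNonsimilar.congr (g.trans e.symm)))
  · intro T T' h
    obtain ⟨e⟩ := hf T.1
    obtain ⟨e'⟩ := hf T'.1
    obtain ⟨g, -⟩ := rootedIso_of_matula_eq (congrArg Subtype.val h)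
    exact Subtype.ext (Quotient.out_equiv_out.1 ⟨(e.trans g).trans e'.symm⟩)

/-- A rooted tree is determined by its underlying tree and the position of its root in the chosen
representative. -/
theorem rootedCount_le (n : ℕ) :
    rootedCount (fun _ => True) n ≤ (n + 1) * Nat.card (Tree (n + 1)) := by
  have hex : ∀ m : matulaSet (fun _ => True) n, ∃ (t : PlaneTree) (T : Tree (n + 1)),
      matula t = m.1 ∧ Nonempty (graph t ≃g T.out.1) := by
    rintro ⟨m, hm, hn, -⟩
    obtain ⟨t, rfl⟩ := exists_matula_eq hm
    have hcard : Fintype.card (Vert t) = n + 1 := by rw [card_vert, ← edges_matula, hn]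
    let e : Vert t ≃ Fin (n + 1) := Fintype.equivFinOfCardEq hcard
    let G : SimpleGraph (Fin (n + 1)) := (graph t).map e.toEmbedding
    let i : graph t ≃g G := SimpleGraph.Iso.map e (graph t)
    let T : Tree (n + 1) := Quotient.mk (treeSetoid (n + 1)) ⟨G, i.isTree_iff.1 (isTree_graph t)⟩
    obtain ⟨j⟩ := Quotient.mk_out (s := treeSetoid (n + 1))
      ⟨G, i.isTree_iff.1 (isTree_graph t)⟩
    exact ⟨t, T, rfl, ⟨i.trans j.symm⟩⟩
  choose t T ht hT using hex
  let e := fun m => (hT m).some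
  rw [rootedCount, ← Nat.card_coe_set_eq]
  refine (Nat.card_le_card_of_injective (β := Fin (n + 1) × Tree (n + 1))
    (fun m => (e m (root (t m)), T m)) ?_).trans ?_
  · intro m m' h
    obtain ⟨h1, h2⟩ := Prod.ext_iff.1 h
    change e m (root (t m)) = e m' (root (t m')) at h1
    change T m = T m' at h2
    apply Subtype.ext
    rw [← ht, ← ht]
    -- The type of `e m` depends on `T m`, so the equality of trees is eliminated with the
    -- isomorphisms generalized.
    have key : ∀ (S S' : Tree (n + 1)), S = S' → ∀ (f : graph (t m) ≃g S.out.1)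
        (f' : graph (t m') ≃g S'.out.1), f (root (t m)) = f' (root (t m')) →
        RootedIso (t m) (t m') := by
      rintro S _ rfl f f' h
      refine ⟨f.trans f'.symm, ?_⟩
      change f'.symm (f (root (t m))) = _
      rw [h]
      simp
    exact matula_eq_of_rootedIso (key _ _ h2 _ _ h1)
  · rw [Nat.card_prod, Nat.card_fin]

theorem card_good_add_card_bad (k n : ℕ) :
    Nat.card {T : Tree n // T.HasCospectralNonsimilar k} +
      Nat.card {T : Tree n // ¬ T.HasCospectralNonsimilar k} = Nat.card (Tree n) := by
  classical
  rw [← Nat.card_sum]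
  exact Nat.card_congr (Equiv.sumCompl _)

theorem almostAllTrees (k : ℕ) : AlmostAllTrees fun T => T.HasCospectralNonsimilar k := by
  have hlim := tendsto_rootedCount_div (MatulaHasLimbVertices k)
    (fun m p hm hp hpm h => h.of_branch hm hp hpm) (by
      obtain ⟨t, ht⟩ := exists_hasLimbVertices k
      exact ⟨matula t, matula_ne_zero t, t, rfl, ht⟩)
  have hpos : ∀ n, (0 : ℝ) < Nat.card (Tree (n + 1)) := fun n => by
    have h1 := rootedCount_le n
    have h2 := rootedCount_pos n
    have : 0 < Nat.card (Tree (n + 1)) := by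
      by_contra h
      rw [Nat.eq_zero_of_not_pos h] at h1
      omega
    exact_mod_cast this
  have hbad : Filter.Tendsto (fun n : ℕ =>
      (Nat.card {T : Tree (n + 1) // ¬ T.HasCospectralNonsimilar k} : ℝ) /
        Nat.card (Tree (n + 1))) Filter.atTop (nhds 0) := by
    refine squeeze_zero (fun n => by positivity) (fun n => ?_) hlim
    have h1 : (Nat.card {T : Tree (n + 1) // ¬ T.HasCospectralNonsimilar k} : ℝ) ≤
      rootedCount (fun m => ¬ MatulaHasLimbVertices k m) n := by exact_mod_cast card_bad_le k n
    have h2 : (rootedCount (fun _ => True) n : ℝ) ≤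
      ((n + 1 : ℕ) : ℝ) * Nat.card (Tree (n + 1)) := by exact_mod_cast rootedCount_le n
    have h3 : (0 : ℝ) < rootedCount (fun _ => True) n := by exact_mod_cast rootedCount_pos n
    rw [div_le_div_iff₀ (hpos n) h3]
    calc _ ≤ (rootedCount (fun m => ¬ MatulaHasLimbVertices k m) n : ℝ) *
          (((n + 1 : ℕ) : ℝ) * Nat.card (Tree (n + 1))) := by gcongr
      _ = _ := by ring
  -- The index moves from vertices to edges; this drops `n = 0`, where there are no trees.
  rw [AlmostAllTrees, ← Filter.tendsto_add_atTop_iff_nat 1]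
  have := hbad.const_sub 1
  rw [sub_zero] at this
  refine this.congr fun n => ?_
  rw [eq_div_iff (hpos n).ne', sub_mul, div_mul_cancel₀ _ (hpos n).ne', one_mul, sub_eq_iff_eq_add]
  exact_mod_cast (card_good_add_card_bad k (n + 1)).symm

end TreeCospec

theorem mainTheorem1 (k : ℕ) (hk : 2 ≤ k) :
    TreeCospec.AlmostAllTrees (fun T => TreeCospec.Tree.HasCospectralNonsimilar k T) :=
  TreeCospec.almostAllTrees k
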